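/- Let $\xi$ be a random variable with $\xi\ge 0$ almost surely, $\mathbb P(\xi=0)<1$ and $\mathbb E[\xi^\alpha]<\infty$ for some $\alpha>1$. Write $m_\gamma=\mathbb E[\xi^\gamma]$ and $\Lambda=\{\gamma>1:\ m_\gamma<\gamma m_1\}$ (in particular $m_\gamma<\infty$ for $\gamma\in\Lambda$), and use the convention $0\log 0=0$. Let $(\xi_n)_{n\ge2}$ be i.i.d. copies of $\xi$ and let $(U[n])_{n\ge2}$ be random variables such that $U[n]$ is uniformly distributed on $\{1,\dots,n-1\}$, all the variables $\xi_n$, $U[n]$ being mutually independent. The pure echoing random walk with echoed steps (memory parameter $p=1$ and spins $X\equiv1$) is $$\tilde S_n=\tilde X_1+\dots+\tilde X_n,\qquad \tilde X_1=1,\qquad \tilde X_n=\xi_n\,\tilde X_{U[n]}\quad(n\ge2).$$ Then there is a random variable $L^{(\xi)}\in L^1(\mathbb P)$ such that $$\lim_{n\to\infty}\frac{\tilde S_n}{n^{m_1}}=L^{(\xi)}\quad\text{almost surely.}$$ Furthermore: i) If $\mathbb E[\xi\log\xi]<m_1$, then for every $\gamma\in\Lambda$ one has $L^{(\xi)}\in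 L^\gamma(\mathbb P)$ and the convergence also holds in $L^\gamma(\mathbb P)$. Moreover $\mathbb E[L^{(\xi)}]=\dfrac{1}{\Gamma(1+m_1)}$, and if $\mathbb P(\xi=1)<1$, then $L^{(\xi)}$ is non-degenerate, that is, not almost surely equal to a constant. ii) If $\mathbb E[\xi\log\xi]\ge m_1$, then $L^{(\xi)}=0$ almost surely. -/

import Mathlib

open MeasureTheory ProbabilityTheory Filter Topology
open scoped ENNReal

/-- The sources of randomness of a random walk with echoed steps. Everything is numbered from `0`:
`spin n` stands for the variable `X_{n+1}`, and `coin n`, `past n`, `echo n` stand for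
`ε_{n+2}`, `U[n+2]`, `ξ_{n+2}`. -/
inductive RWESSource : Type
  | spin (n : ℕ)
  | coin (n : ℕ)
  | past (n : ℕ)
  | echo (n : ℕ)

/-- The sigma-algebra generated by a single source of randomness. -/
@[reducible] def RWESSource.sigma {Ω : Type*} (X ε ξ : ℕ → Ω → ℝ) (U : (n : ℕ) → Ω → Fin (n + 1)) :
    RWESSource → MeasurableSpace Ω
  | .spin n => MeasurableSpace.comap (X n) inferInstance
  | .coin n => MeasurableSpace.comap (ε n) inferInstance
  | .past n => MeasurableSpace.comap (U n) inferInstance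
  | .echo n => MeasurableSpace.comap (ξ n) inferInstance

/-- The data of a random walk with echoed steps on `(Ω, P)` with memory parameter `p`, spin law `ν`
and echo law `μ`: spins `X_{n+1} = X n` with law `ν`, Bernoulli(`p`) variables `ε_{n+2} = ε n`,
echo variables `ξ_{n+2} = ξ n` with law `μ`, and uniform samples of the past, all of them mutually
independent. The sample at time `n + 2` is uniform over the `n + 1` earlier steps, which are
numbered `0, …, n`, so that `U[n+2] = U n + 1`. -/
structure RWES {Ω : Type*} [MeasurableSpace Ω] (P : Measure Ω) (p : ℝ) (ν μ : Measure ℝ) where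
  X : ℕ → Ω → ℝ
  ε : ℕ → Ω → ℝ
  U : (n : ℕ) → Ω → Fin (n + 1)
  ξ : ℕ → Ω → ℝ
  measurable_X : ∀ n, Measurable (X n)
  measurable_ε : ∀ n, Measurable (ε n)
  measurable_U : ∀ n, Measurable (U n)
  measurable_ξ : ∀ n, Measurable (ξ n)
  law_X : ∀ n, P.map (X n) = ν
  law_ε : ∀ n, P.map (ε n) =
    ENNReal.ofReal p • Measure.dirac 1 + ENNReal.ofReal (1 - p) • Measure.dirac 0
  law_U : ∀ n (k : Fin (n + 1)), P {ω | U n ω = k} = ((n + 1 : ℕ) : ℝ≥0∞)⁻¹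
  law_ξ : ∀ n, P.map (ξ n) = μ
  indep : iIndep (RWESSource.sigma X ε ξ U) P

namespace RWES

variable {Ω : Type*} [MeasurableSpace Ω] {P : Measure Ω} {p : ℝ} {ν μ : Measure ℝ}

/-- The echoed steps, `W.step ω n` being the `(n+1)`-st increment of the walk: the first one is
`X_1`, and each later one is either the new spin (if the coin shows `0`) or an echo of a uniformly
sampled earlier increment (if the coin shows `1`). -/
noncomputable def step (W : RWES P p ν μ) (ω : Ω) : ℕ → ℝ
  | 0 => W.X 0 ω
  | n + 1 => (1 - W.ε n ω) * W.X (n + 1) ω + W.ε n ω * W.ξ n ω * W.step ω (W.U n ω : ℕ)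
decreasing_by exact (W.U n ω).isLt

/-- The position of the walk after `n` steps. -/
noncomputable def walk (W : RWES P p ν μ) (n : ℕ) (ω : Ω) : ℝ :=
  ∑ k ∈ Finset.range n, W.step ω k

end RWES

/-- The moment `m_γ = E[ξ^γ]` of the echo law `μ`. -/
noncomputable def echoMoment (μ : Measure ℝ) (γ : ℝ) : ℝ := ∫ x, x ^ γ ∂μ

/-- The set `Λ` of all `γ > 1` with `E|X|^γ < ∞` and `m_γ < γ m_1`, for the spin law `ν` and the
echo law `μ`; the inequality `m_γ < γ m_1` includes that `m_γ` is finite. -/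
def echoExponents (ν μ : Measure ℝ) : Set ℝ :=
  {γ | 1 < γ ∧ Integrable (fun x => |x| ^ γ) ν ∧
    Integrable (fun x => x ^ γ) μ ∧ echoMoment μ γ < γ * echoMoment μ 1}

/-! Write m for m_1. After n steps the next increment has conditional mean m/n times the current
position, so the walk divided by its mean ∏ (1 + m/k) is a nonnegative martingale. That mean is
asymptotic to n^m / Γ(1 + m) by Euler's formula for Γ, which yields the almost sure limit L
(`ae_tendsto_limitWalk`).

The finer statements rest on a branching identity. Regard each increment as a child of the increment
it echoes. Cutting the edge between the first two increments splits the family tree into two trees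
whose relative sizes are uniform and which are independent given the sizes. Hence S_{N+2} has the
law of S_{i+1} + ξ S'_{N-i+1} with i uniform on {0, …, N}. The proof avoids trees: it treats E ∏
φ(X_k) for all bounded φ at once, and differentiating in the direction φ(x) E φ(ξx) raises the
number of steps by one, so the identity follows by induction on N (`prodMean_split`). Letting N tend
to infinity gives the smoothing equation L = u^m L' + (1 - u)^m ξ L'' in law, with u uniform on
(0,1) (`map_limitWalk_eq_map_smoothing`).

Convergence in L^γ: the branching identity bounds the γ-th moment by (1 + m_γ) times the average of
its earlier values, plus cross terms of order N^{γm} controlled by lower moments. Averaging k^{γm}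
costs a factor 1/(1 + γm), so m_γ < γm makes the recursion contract (`hasMomentGrowth`), and the
martingale is bounded in L^γ. If E[ξ log ξ] < m then Λ is nonempty, because E[ξ log ξ] is the
derivative of γ ↦ m_γ at 1.

Case E[ξ log ξ] ≥ m: compare moments of order θ < 1 of the two sides of the smoothing equation. The
defect of subadditivity of x^θ is at least (1 - θ) min(1, x, y). Dividing by 1 - θ and letting θ ↑ 1
forces one of the two summands to vanish almost surely, hence L = 0 (`limitWalk_ae_eq_zero`).
Finally, if L is a nonzero constant, letting u tend to 0 in the smoothing equation gives ξ = 1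
(`echo_eq_one_of_limitWalk_const`). -/

namespace RWES

/-! ### The pure walk, its filtration, and independence from the past. -/

variable {Ω : Type*} [mΩ : MeasurableSpace Ω] {P : Measure Ω} {p : ℝ} {ν μ : Measure ℝ}

/-- The increments of the pure echoing walk with unit spins: `1` at first, then each increment is
the echo of a uniformly sampled earlier one. -/
noncomputable def pureStep (W : RWES P p ν μ) (ω : Ω) : ℕ → ℝ
  | 0 => 1
  | n + 1 => W.ξ n ω * W.pureStep ω (W.U n ω : ℕ)
decreasing_by exact (W.U n ω).isLt

/-- The pure echoing walk with unit spins. -/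
noncomputable def pureWalk (W : RWES P p ν μ) (n : ℕ) (ω : Ω) : ℝ :=
  ∑ k ∈ Finset.range n, W.pureStep ω k

@[simp] lemma pureStep_zero (W : RWES P p ν μ) (ω : Ω) : W.pureStep ω 0 = 1 := by
  rw [pureStep]

lemma pureStep_succ (W : RWES P p ν μ) (ω : Ω) (n : ℕ) :
    W.pureStep ω (n + 1) = W.ξ n ω * W.pureStep ω (W.U n ω : ℕ) := by
  rw [pureStep]

@[simp] lemma pureWalk_zero (W : RWES P p ν μ) (ω : Ω) : W.pureWalk 0 ω = 0 := by
  simp [pureWalk]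

@[simp] lemma pureWalk_one (W : RWES P p ν μ) (ω : Ω) : W.pureWalk 1 ω = 1 := by
  simp [pureWalk]

lemma pureWalk_succ (W : RWES P p ν μ) (n : ℕ) (ω : Ω) :
    W.pureWalk (n + 1) ω = W.pureWalk n ω + W.pureStep ω n := by
  simp [pureWalk, Finset.sum_range_succ]

lemma step_ae_eq_pureStep (W : RWES P 1 (Measure.dirac 1) μ) :
    ∀ᵐ ω ∂P, ∀ n, W.step ω n = W.pureStep ω n := by
  have hX : ∀ᵐ ω ∂P, W.X 0 ω = 1 := by
    have : ∀ᵐ x ∂(P.map (W.X 0)), x = 1 := by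
      rw [W.law_X 0]; simp
    exact ae_of_ae_map (W.measurable_X 0).aemeasurable this
  have hε : ∀ᵐ ω ∂P, ∀ n, W.ε n ω = 1 := by
    refine ae_all_iff.2 fun n => ?_
    have : ∀ᵐ x ∂(P.map (W.ε n)), x = 1 := by
      rw [W.law_ε n]
      simp
    exact ae_of_ae_map (W.measurable_ε n).aemeasurable this
  filter_upwards [hX, hε] with ω hX hε n
  induction n using Nat.strong_induction_on with
  | _ n ih =>
    cases n with
    | zero => rw [step, pureStep_zero, hX]
    | succ n =>
      rw [step, pureStep_succ, hε n, ih _ (W.U n ω).isLt]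
      ring

lemma walk_ae_eq_pureWalk (W : RWES P 1 (Measure.dirac 1) μ) :
    ∀ᵐ ω ∂P, ∀ n, W.walk n ω = W.pureWalk n ω := by
  filter_upwards [W.step_ae_eq_pureStep] with ω h n
  simp [walk, pureWalk, h]

lemma ae_ξ_nonneg (W : RWES P p ν μ) (hμ : ∀ᵐ x ∂μ, 0 ≤ x) : ∀ᵐ ω ∂P, ∀ n, 0 ≤ W.ξ n ω := by
  refine ae_all_iff.2 fun n => ?_
  rw [← W.law_ξ n] at hμ
  exact ae_of_ae_map (W.measurable_ξ n).aemeasurable hμ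

lemma ae_pureStep_nonneg (W : RWES P p ν μ) (hμ : ∀ᵐ x ∂μ, 0 ≤ x) :
    ∀ᵐ ω ∂P, ∀ n, 0 ≤ W.pureStep ω n := by
  filter_upwards [W.ae_ξ_nonneg hμ] with ω h n
  induction n using Nat.strong_induction_on with
  | _ n ih =>
    cases n with
    | zero => simp
    | succ n =>
      rw [pureStep_succ]
      exact mul_nonneg (h n) (ih _ (W.U n ω).isLt)

lemma ae_pureWalk_nonneg (W : RWES P p ν μ) (hμ : ∀ᵐ x ∂μ, 0 ≤ x) :
    ∀ᵐ ω ∂P, ∀ n, 0 ≤ W.pureWalk n ω := by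
  filter_upwards [W.ae_pureStep_nonneg hμ] with ω h n
  exact Finset.sum_nonneg fun k _ => h k

/-- The sources of randomness used by the first `n + 1` increments of the pure walk. -/
def pastSources (n : ℕ) : Set RWESSource :=
  {s | ∃ i < n, s = .past i ∨ s = .echo i}

/-- The sigma-algebra generated by a source of randomness of `W`. -/
abbrev sigma (W : RWES P p ν μ) : RWESSource → MeasurableSpace Ω :=
  RWESSource.sigma W.X W.ε W.ξ W.U

lemma sigma_le (W : RWES P p ν μ) (s : RWESSource) : W.sigma s ≤ mΩ := by
  cases s with
  | spin n => exact (W.measurable_X n).comap_le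
  | coin n => exact (W.measurable_ε n).comap_le
  | past n => exact (W.measurable_U n).comap_le
  | echo n => exact (W.measurable_ξ n).comap_le

/-- The filtration of the pure walk: at time `n` the first `n + 1` increments are known. -/
def filtration (W : RWES P p ν μ) : Filtration ℕ mΩ where
  seq n := ⨆ s ∈ pastSources n, W.sigma s
  mono' _ _ hnk := biSup_mono fun _ ⟨i, hi, h⟩ => ⟨i, hi.trans_le hnk, h⟩
  le' _ := iSup₂_le fun s _ => W.sigma_le s

lemma measurable_filtration_U (W : RWES P p ν μ) {i n : ℕ} (h : i < n) :
    Measurable[W.filtration n] (W.U i) := by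
  have h1 : W.sigma (.past i) ≤ W.filtration n :=
    le_iSup₂_of_le (f := fun s (_ : s ∈ pastSources n) => W.sigma s) (.past i)
      ⟨i, h, Or.inl rfl⟩ le_rfl
  exact (comap_measurable (W.U i)).mono h1 le_rfl

lemma measurable_filtration_ξ (W : RWES P p ν μ) {i n : ℕ} (h : i < n) :
    Measurable[W.filtration n] (W.ξ i) := by
  have h1 : W.sigma (.echo i) ≤ W.filtration n :=
    le_iSup₂_of_le (f := fun s (_ : s ∈ pastSources n) => W.sigma s) (.echo i)
      ⟨i, h, Or.inr rfl⟩ le_rfl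
  exact (comap_measurable (W.ξ i)).mono h1 le_rfl

/-- Replaces the random index by a finite sum in which each term is a past quantity times a function
of `(U n, ξ n)`. Measurability, integrability and conditional expectations can then be handled term
by term. -/
lemma pureStep_succ_eq_sum (W : RWES P p ν μ) (ω : Ω) (n : ℕ) :
    W.pureStep ω (n + 1) = ∑ j : Fin (n + 1),
      W.pureStep ω j * ((W.U n ⁻¹' {j}).indicator (W.ξ n) ω) := by
  rw [pureStep_succ, Finset.sum_eq_single (W.U n ω)]
  · simp [mul_comm]
  · intro j _ hj
    rw [Set.indicator_of_notMem (by simpa using hj.symm), mul_zero]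
  · simp

lemma measurable_filtration_pureStep (W : RWES P p ν μ) {k n : ℕ} (h : k ≤ n) :
    Measurable[W.filtration n] (fun ω => W.pureStep ω k) := by
  induction k using Nat.strong_induction_on with
  | _ k ih =>
    cases k with
    | zero => simp only [pureStep_zero]; exact measurable_const
    | succ k =>
      simp only [pureStep_succ_eq_sum]
      refine Finset.measurable_sum _ fun j _ => ?_
      refine (ih j (by omega) (by omega)).mul ?_
      exact (W.measurable_filtration_ξ h).indicator
        (W.measurable_filtration_U h (measurableSet_singleton _))

lemma measurable_pureStep (W : RWES P p ν μ) (k : ℕ) : Measurable (fun ω => W.pureStep ω k) :=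
  (W.measurable_filtration_pureStep le_rfl).mono (W.filtration.le k) le_rfl

lemma measurable_filtration_pureWalk (W : RWES P p ν μ) (n : ℕ) :
    Measurable[W.filtration n] (W.pureWalk (n + 1)) :=
  Finset.measurable_fun_sum _ fun _ hk =>
    W.measurable_filtration_pureStep (Nat.lt_succ_iff.1 (Finset.mem_range.1 hk))

lemma measurable_pureWalk (W : RWES P p ν μ) (n : ℕ) : Measurable (W.pureWalk n) :=
  Finset.measurable_fun_sum _ fun k _ => W.measurable_pureStep k

lemma indep_filtration (W : RWES P p ν μ) (n : ℕ) :
    Indep (MeasurableSpace.comap (fun ω => (W.U n ω, W.ξ n ω)) inferInstance)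
      (W.filtration n) P := by
  have hdisj : Disjoint ({.past n, .echo n} : Set RWESSource) (pastSources n) := by
    rw [Set.disjoint_left]
    rintro s hs ⟨i, hi, h⟩
    rcases hs with rfl | rfl <;> rcases h with h | h <;> cases h <;> omega
  have h := indep_iSup_of_disjoint W.sigma_le W.indep hdisj
  refine indep_of_indep_of_le_left h ?_
  rw [iSup_pair]
  exact (MeasurableSpace.comap_prodMk (W.U n) (W.ξ n)).le

lemma indepFun_U_ξ (W : RWES P p ν μ) (n : ℕ) : IndepFun (W.U n) (W.ξ n) P := by
  rw [IndepFun_iff_Indep]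
  exact W.indep.indep (i := .past n) (j := .echo n) (by simp)

lemma map_U_real_singleton (W : RWES P p ν μ) (n : ℕ) (j : Fin (n + 1)) :
    (P.map (W.U n)).real {j} = ((n : ℝ) + 1)⁻¹ := by
  have h := W.law_U n j
  rw [measureReal_def, Measure.map_apply (W.measurable_U n) (measurableSet_singleton _)]
  have h2 : W.U n ⁻¹' {j} = {ω | W.U n ω = j} := rfl
  rw [h2, h, ENNReal.toReal_inv, ENNReal.toReal_natCast]
  simp

/-- Averaging over the sample and the echo at time `n`, given the past. -/
lemma integral_past_U_ξ [IsProbabilityMeasure P] (W : RWES P p ν μ) [IsProbabilityMeasure μ]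
    {β E : Type*} [MeasurableSpace β] [NormedAddCommGroup E] [NormedSpace ℝ E] [CompleteSpace E]
    (n : ℕ) {V : Ω → β} (hV : Measurable[W.filtration n] V) {f : Fin (n + 1) → β × ℝ → E}
    (hf : ∀ j, StronglyMeasurable (f j)) {C : ℝ} (hC : ∀ j z, ‖f j z‖ ≤ C) :
    ∫ ω, f (W.U n ω) (V ω, W.ξ n ω) ∂P =
      ((n : ℝ) + 1)⁻¹ • ∑ j, ∫ ω, ∫ y, f j (V ω, y) ∂μ ∂P := by
  have hV' : Measurable V := hV.mono (W.filtration.le n) le_rfl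
  have hUm := W.measurable_U n
  have hξm := W.measurable_ξ n
  have h1 : IndepFun (fun ω => (W.U n ω, W.ξ n ω)) V P := by
    rw [IndepFun_iff_Indep]
    exact indep_of_indep_of_le_right (W.indep_filtration n) hV.comap_le
  have h2 := h1.map_prod_eq_prod_map_map (hUm.prodMk hξm).aemeasurable hV'.aemeasurable
  rw [(W.indepFun_U_ξ n).map_prod_eq_prod_map_map hUm.aemeasurable hξm.aemeasurable,
    W.law_ξ n] at h2
  have : IsProbabilityMeasure (P.map (W.U n)) := Measure.isProbabilityMeasure_map hUm.aemeasurable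
  have : IsProbabilityMeasure (P.map V) := Measure.isProbabilityMeasure_map hV'.aemeasurable
  let g : (Fin (n + 1) × ℝ) × β → E := fun z => f z.1.1 (z.2, z.1.2)
  have hg : StronglyMeasurable g := by
    have : g = fun z => ∑ j : Fin (n + 1),
        ({z : (Fin (n + 1) × ℝ) × β | z.1.1 = j}.indicator fun z => f j (z.2, z.1.2)) z := by
      funext z
      rw [Finset.sum_eq_single z.1.1]
      · simp [g]
      · intro j _ hj
        exact Set.indicator_of_notMem (by simpa using hj.symm) _
      · simp
    rw [this]
    refine Finset.stronglyMeasurable_fun_sum _ fun j _ => ?_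
    refine ((hf j).comp_measurable (by fun_prop)).indicator ?_
    exact (measurable_fst.comp measurable_fst) (measurableSet_singleton j)
  have hint : ∀ (ρ : Measure ((Fin (n + 1) × ℝ) × β)) [IsFiniteMeasure ρ], Integrable g ρ :=
    fun ρ _ => Integrable.of_bound hg.aestronglyMeasurable C (ae_of_all _ fun z => hC _ _)
  have h3 : ∫ ω, f (W.U n ω) (V ω, W.ξ n ω) ∂P =
      ∫ z, g z ∂(P.map fun ω => ((W.U n ω, W.ξ n ω), V ω)) := by
    rw [integral_map ((hUm.prodMk hξm).prodMk hV').aemeasurable hg.aestronglyMeasurable]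
  rw [h3, h2, integral_prod _ (hint _), integral_prod _ (Integrable.integral_prod_left (hint _)),
    integral_fintype, Finset.smul_sum]
  swap
  · exact Integrable.of_finite
  refine Finset.sum_congr rfl fun j _ => ?_
  rw [map_U_real_singleton]
  congr 1
  have hfj : Integrable (fun z : ℝ × β => f j (z.2, z.1)) (μ.prod (P.map V)) :=
    Integrable.of_bound ((hf j).comp_measurable (by fun_prop)).aestronglyMeasurable C
      (ae_of_all _ fun z => hC _ _)
  have h4 : ∫ y, ∫ v, g ((j, y), v) ∂(P.map V) ∂μ = ∫ v, ∫ y, f j (v, y) ∂μ ∂(P.map V) :=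
    integral_integral_swap hfj
  rw [h4, integral_map hV'.aemeasurable]
  exact ((hf j).integral_prod_right (f := fun v y => f j (v, y))).aestronglyMeasurable

end RWES

/-! ### Multiplicative functionals of the increments and their directional derivatives. -/

section ProdMean

variable {Ω : Type*} [MeasurableSpace Ω]

/-- The expectation of the product of `φ` over the first `n` variables of a sequence. -/
noncomputable def prodMean (Q : Measure Ω) (Z : ℕ → Ω → ℝ) (φ : ℝ → ℂ) (n : ℕ) : ℂ :=
  ∫ ω, ∏ k ∈ Finset.range n, φ (Z k ω) ∂Q

/-- The derivative of `prodMean` at `φ` in the direction `ψ`. -/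
noncomputable def prodMeanDeriv (Q : Measure Ω) (Z : ℕ → Ω → ℝ) (φ ψ : ℝ → ℂ) (n : ℕ) : ℂ :=
  ∫ ω, ∑ j ∈ Finset.range n, (∏ k ∈ (Finset.range n).erase j, φ (Z k ω)) * ψ (Z j ω) ∂Q

/-- The product rule under the integral sign. For |t| ≤ 1 each factor φ + tψ is bounded by C + 1 *
C, which supplies the dominating constant. -/
lemma hasDerivAt_prodMean (Q : Measure Ω) [IsFiniteMeasure Q] {Z : ℕ → Ω → ℝ}
    (hZ : ∀ k, Measurable (Z k)) {φ ψ : ℝ → ℂ} (hφ : Measurable φ) (hψ : Measurable ψ) {C : ℝ}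
    (hφC : ∀ x, ‖φ x‖ ≤ C) (hψC : ∀ x, ‖ψ x‖ ≤ C) (n : ℕ) :
    HasDerivAt (fun t : ℝ => prodMean Q Z (fun x => φ x + t * ψ x) n)
      (prodMeanDeriv Q Z φ ψ n) 0 := by
  have hbound : ∀ t ∈ Metric.ball (0 : ℝ) 1, ∀ x, ‖φ x + t * ψ x‖ ≤ C + 1 * C := by
    intro t ht x
    refine (norm_add_le _ _).trans (add_le_add (hφC x) ?_)
    rw [norm_mul, Complex.norm_real]
    have : ‖t‖ ≤ 1 := by simpa using (Metric.mem_ball.1 ht).le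
    gcongr
    exact hψC x
  have hmeas : ∀ t : ℝ, Measurable fun ω => ∏ k ∈ Finset.range n, (φ (Z k ω) + t * ψ (Z k ω)) :=
    fun t => Finset.measurable_fun_prod _ fun k _ =>
      (hφ.comp (hZ k)).add ((hψ.comp (hZ k)).const_mul _)
  have hmeas' : ∀ t : ℝ, Measurable fun ω => ∑ j ∈ Finset.range n,
      (∏ k ∈ (Finset.range n).erase j, (φ (Z k ω) + t * ψ (Z k ω))) * ψ (Z j ω) :=
    fun t => Finset.measurable_fun_sum _ fun j _ => (Finset.measurable_fun_prod _ fun k _ =>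
      (hφ.comp (hZ k)).add ((hψ.comp (hZ k)).const_mul _)).mul (hψ.comp (hZ j))
  have h := hasDerivAt_integral_of_dominated_loc_of_deriv_le (μ := Q) (x₀ := (0 : ℝ))
    (s := Metric.ball 0 1)
    (F := fun (t : ℝ) ω => ∏ k ∈ Finset.range n, (φ (Z k ω) + t * ψ (Z k ω)))
    (F' := fun (t : ℝ) ω => ∑ j ∈ Finset.range n,
      (∏ k ∈ (Finset.range n).erase j, (φ (Z k ω) + t * ψ (Z k ω))) * ψ (Z j ω))
    (bound := fun _ => ∑ j ∈ Finset.range n, (∏ _k ∈ (Finset.range n).erase j, (C + 1 * C)) * C)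
    (Metric.ball_mem_nhds _ one_pos)
    (Eventually.of_forall fun t => (hmeas t).aestronglyMeasurable)
    ?_ (hmeas' 0).aestronglyMeasurable ?_ (integrable_const _) ?_
  · have h2 := h.2
    simpa [prodMean, prodMeanDeriv] using h2
  · refine Integrable.of_bound (hmeas 0).aestronglyMeasurable
      (∏ _k ∈ Finset.range n, (C + 1 * C)) (ae_of_all _ fun ω => ?_)
    rw [norm_prod]
    exact Finset.prod_le_prod (fun _ _ => norm_nonneg _)
      fun k _ => hbound 0 (Metric.mem_ball_self one_pos) _
  · refine ae_of_all _ fun ω t ht => (norm_sum_le _ _).trans (Finset.sum_le_sum fun j _ => ?_)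
    rw [norm_mul, norm_prod]
    have hC : 0 ≤ C := (norm_nonneg _).trans (hφC 0)
    refine mul_le_mul ?_ (hψC _) (norm_nonneg _) (Finset.prod_nonneg fun _ _ => by positivity)
    exact Finset.prod_le_prod (fun _ _ => norm_nonneg _) fun k _ => hbound t ht _
  · refine ae_of_all _ fun ω t _ => ?_
    have h1 : ∀ k ∈ Finset.range n,
        HasDerivAt (fun t : ℝ => φ (Z k ω) + t * ψ (Z k ω)) (ψ (Z k ω)) t := by
      intro k _
      have := ((Complex.ofRealCLM.hasDerivAt (x := t)).mul_const (ψ (Z k ω))).const_add (φ (Z k ω))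
      simpa using this
    simpa [smul_eq_mul] using HasDerivAt.fun_finsetProd h1

end ProdMean

/-! ### The branching identity for multiplicative functionals. -/

namespace RWES

variable {Ω : Type*} [mΩ : MeasurableSpace Ω] {P : Measure Ω} {p : ℝ} {ν μ : Measure ℝ}

/-- The increments of the walk multiplied by an independent echo. -/
noncomputable def scaledStep (W : RWES P p ν μ) (k : ℕ) (z : ℝ × Ω) : ℝ := z.1 * W.pureStep z.2 k

lemma measurable_scaledStep (W : RWES P p ν μ) (k : ℕ) : Measurable (W.scaledStep k) :=
  measurable_fst.mul ((W.measurable_pureStep k).comp measurable_snd)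

lemma measurable_echo_average [IsProbabilityMeasure μ] {φ : ℝ → ℂ} (hφ : Measurable φ) :
    Measurable fun x => ∫ y, φ (y * x) ∂μ := by
  have : StronglyMeasurable (Function.uncurry fun x y : ℝ => φ (y * x)) :=
    (hφ.comp (by fun_prop : Measurable fun z : ℝ × ℝ => z.2 * z.1)).stronglyMeasurable
  exact this.integral_prod_right.measurable

lemma norm_echo_average_le [IsProbabilityMeasure μ] {φ : ℝ → ℂ} {C : ℝ} (hC : ∀ x, ‖φ x‖ ≤ C)
    (x : ℝ) : ‖∫ y, φ (y * x) ∂μ‖ ≤ C := by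
  simpa using norm_integral_le_of_norm_le_const (μ := μ) (ae_of_all _ fun y => hC (y * x))

/-- Differentiating the product in this direction attaches to each increment in turn a child
carrying an independent echo. The sum over the parents is n + 1 times the average over the uniform
parent, that is, one more step of the walk. -/
lemma prodMeanDeriv_echo [IsProbabilityMeasure P] [IsProbabilityMeasure μ] (W : RWES P p ν μ)
    {φ : ℝ → ℂ} (hφ : Measurable φ) {C : ℝ} (hC : ∀ x, ‖φ x‖ ≤ C) (n : ℕ) :
    prodMeanDeriv P (fun k ω => W.pureStep ω k) φ (fun x => φ x * ∫ y, φ (y * x) ∂μ) (n + 1) =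
      (n + 1) * prodMean P (fun k ω => W.pureStep ω k) φ (n + 2) := by
  have hC0 : 0 ≤ C := (norm_nonneg _).trans (hC 0)
  have hV : Measurable[W.filtration n] fun ω => fun j : Fin (n + 1) => W.pureStep ω j :=
    @measurable_pi_lambda _ _ _ (W.filtration n) _ _ fun j =>
      W.measurable_filtration_pureStep (Nat.lt_succ_iff.1 j.isLt)
  have hfm : ∀ j : Fin (n + 1), StronglyMeasurable fun z : (Fin (n + 1) → ℝ) × ℝ =>
      (∏ k, φ (z.1 k)) * φ (z.2 * z.1 j) := fun j =>
    ((Finset.measurable_fun_prod _ fun k _ => hφ.comp (by fun_prop)).mul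
      (hφ.comp (by fun_prop))).stronglyMeasurable
  have h := W.integral_past_U_ξ n hV (f := fun j z => (∏ k, φ (z.1 k)) * φ (z.2 * z.1 j))
    (C := (∏ _k : Fin (n + 1), C) * C) hfm (fun j z => by
      rw [norm_mul, norm_prod]
      exact mul_le_mul (Finset.prod_le_prod (fun _ _ => norm_nonneg _) fun _ _ => hC _) (hC _)
        (norm_nonneg _) (Finset.prod_nonneg fun _ _ => hC0))
  have h1 : prodMean P (fun k ω => W.pureStep ω k) φ (n + 2) =
      ∫ ω, (∏ k : Fin (n + 1), φ (W.pureStep ω k)) *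
        φ (W.ξ n ω * W.pureStep ω (W.U n ω : ℕ)) ∂P := by
    refine integral_congr_ae (ae_of_all _ fun ω => ?_)
    simp only
    rw [Finset.prod_range_succ, pureStep_succ, Finset.prod_range]
  rw [h1, h]
  have hn : ((n : ℂ) + 1) ≠ 0 := by exact_mod_cast n.succ_ne_zero
  have h2 : prodMeanDeriv P (fun k ω => W.pureStep ω k) φ (fun x => φ x * ∫ y, φ (y * x) ∂μ)
      (n + 1) = ∫ ω, ∑ j : Fin (n + 1),
        ∫ y, (∏ k : Fin (n + 1), φ (W.pureStep ω k)) * φ (y * W.pureStep ω j) ∂μ ∂P := by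
    refine integral_congr_ae (ae_of_all _ fun ω => ?_)
    simp only
    rw [← Fin.sum_univ_eq_sum_range (fun j => (∏ k ∈ (Finset.range (n + 1)).erase j,
      φ (W.pureStep ω k)) * (φ (W.pureStep ω j) * ∫ y, φ (y * W.pureStep ω j) ∂μ))]
    refine Finset.sum_congr rfl fun j _ => ?_
    rw [← mul_assoc, Finset.prod_erase_mul _ _ (Finset.mem_range.2 j.isLt), integral_const_mul,
      Finset.prod_range]
  rw [h2, integral_finsetSum]
  · rw [Complex.real_smul]
    push_cast
    field_simp
  · intro j _
    have hsm : StronglyMeasurable fun ω =>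
        ∫ y, (∏ k : Fin (n + 1), φ (W.pureStep ω k)) * φ (y * W.pureStep ω j) ∂μ := by
      have : StronglyMeasurable (Function.uncurry fun (ω : Ω) (y : ℝ) =>
          (∏ k : Fin (n + 1), φ (W.pureStep ω k)) * φ (y * W.pureStep ω j)) := by
        refine (Measurable.mul (Finset.measurable_fun_prod _ fun k _ => ?_) ?_).stronglyMeasurable
        · exact hφ.comp ((W.measurable_pureStep k).comp measurable_fst)
        · exact hφ.comp (measurable_snd.mul ((W.measurable_pureStep j).comp measurable_fst))
      exact this.integral_prod_right
    refine Integrable.of_bound hsm.aestronglyMeasurable ((∏ _k : Fin (n + 1), C) * C)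
      (ae_of_all _ fun ω => ?_)
    have : ∀ y, ‖(∏ k : Fin (n + 1), φ (W.pureStep ω k)) * φ (y * W.pureStep ω j)‖ ≤
        (∏ _k : Fin (n + 1), C) * C := by
      intro y
      rw [norm_mul, norm_prod]
      exact mul_le_mul (Finset.prod_le_prod (fun _ _ => norm_nonneg _) fun _ _ => hC _) (hC _)
        (norm_nonneg _) (Finset.prod_nonneg fun _ _ => hC0)
    simpa using norm_integral_le_of_norm_le_const (μ := μ) (ae_of_all _ this)

lemma prodMean_scaledStep [IsProbabilityMeasure P] [IsProbabilityMeasure μ] (W : RWES P p ν μ)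
    {φ : ℝ → ℂ} (hφ : Measurable φ) {C : ℝ} (hC : ∀ x, ‖φ x‖ ≤ C) (n : ℕ) :
    prodMean (μ.prod P) W.scaledStep φ n =
      ∫ y, prodMean P (fun k ω => W.pureStep ω k) (fun x => φ (y * x)) n ∂μ := by
  refine integral_prod (fun z => ∏ k ∈ Finset.range n, φ (W.scaledStep k z)) ?_
  refine Integrable.of_bound (Finset.measurable_fun_prod _ fun k _ =>
    hφ.comp (W.measurable_scaledStep k)).aestronglyMeasurable (∏ _k ∈ Finset.range n, C)
    (ae_of_all _ fun z => ?_)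
  rw [norm_prod]
  exact Finset.prod_le_prod (fun _ _ => norm_nonneg _) fun _ _ => hC _

lemma prodMeanDeriv_scaledStep [IsProbabilityMeasure P] [IsProbabilityMeasure μ]
    (W : RWES P p ν μ) {φ ψ : ℝ → ℂ} (hφ : Measurable φ) (hψ : Measurable ψ) {C : ℝ}
    (hC : ∀ x, ‖φ x‖ ≤ C) (hψC : ∀ x, ‖ψ x‖ ≤ C) (n : ℕ) :
    prodMeanDeriv (μ.prod P) W.scaledStep φ ψ n =
      ∫ y, prodMeanDeriv P (fun k ω => W.pureStep ω k) (fun x => φ (y * x))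
        (fun x => ψ (y * x)) n ∂μ := by
  have hC0 : 0 ≤ C := (norm_nonneg _).trans (hC 0)
  refine integral_prod (fun z => ∑ j ∈ Finset.range n,
    (∏ k ∈ (Finset.range n).erase j, φ (W.scaledStep k z)) * ψ (W.scaledStep j z)) ?_
  refine integrable_finsetSum _ fun j _ => ?_
  refine Integrable.of_bound ((Finset.measurable_fun_prod _ fun k _ =>
    hφ.comp (W.measurable_scaledStep k)).mul
      (hψ.comp (W.measurable_scaledStep j))).aestronglyMeasurable
    ((∏ _k ∈ (Finset.range n).erase j, C) * C) (ae_of_all _ fun z => ?_)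
  rw [norm_mul, norm_prod]
  exact mul_le_mul (Finset.prod_le_prod (fun _ _ => norm_nonneg _) fun _ _ => hC _) (hψC _)
    (norm_nonneg _) (Finset.prod_nonneg fun _ _ => hC0)

/-- The direction φ(x) E φ(ξx) commutes with the scaling x ↦ yx, so the unscaled identity can be
integrated over y. -/
lemma prodMeanDeriv_scaledStep_echo [IsProbabilityMeasure P] [IsProbabilityMeasure μ]
    (W : RWES P p ν μ) {φ : ℝ → ℂ} (hφ : Measurable φ) {C : ℝ} (hC : ∀ x, ‖φ x‖ ≤ C) (n : ℕ) :
    prodMeanDeriv (μ.prod P) W.scaledStep φ (fun x => φ x * ∫ y, φ (y * x) ∂μ) (n + 1) =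
      (n + 1) * prodMean (μ.prod P) W.scaledStep φ (n + 2) := by
  have hC0 : 0 ≤ C := (norm_nonneg _).trans (hC 0)
  rw [prodMean_scaledStep W hφ hC, prodMeanDeriv_scaledStep W hφ
    (ψ := fun x => φ x * ∫ y, φ (y * x) ∂μ) (hφ.mul (measurable_echo_average hφ)) (C := C + C * C)
    (fun x => (hC x).trans (by nlinarith)) (fun x => ?_), ← integral_const_mul]
  · refine integral_congr_ae (ae_of_all _ fun y => ?_)
    simp only
    rw [← W.prodMeanDeriv_echo (φ := fun x => φ (y * x)) (hφ.comp (by fun_prop)) (fun x => hC _)]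
    simp only [mul_left_comm]
  · rw [norm_mul]
    have := mul_le_mul (hC x) (norm_echo_average_le (μ := μ) hC x) (norm_nonneg _) hC0
    linarith

/-- Splitting at the second increment: the descendants of the first two increments form two
independent walks, the numbers of steps being uniform. -/
theorem prodMean_split [IsProbabilityMeasure P] [IsProbabilityMeasure μ] (W : RWES P p ν μ)
    (N : ℕ) {φ : ℝ → ℂ} (hφ : Measurable φ) {C : ℝ} (hC : ∀ x, ‖φ x‖ ≤ C) :
    (N + 1) * prodMean P (fun k ω => W.pureStep ω k) φ (N + 2) =
      ∑ ij ∈ Finset.HasAntidiagonal.antidiagonal N,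
        prodMean P (fun k ω => W.pureStep ω k) φ (ij.1 + 1) *
        prodMean (μ.prod P) W.scaledStep φ (ij.2 + 1) := by
  induction N generalizing φ C with
  | zero =>
    have h := W.prodMeanDeriv_echo hφ hC 0
    simp only [Nat.cast_zero, zero_add, one_mul] at h ⊢
    rw [← h]
    rw [Finset.HasAntidiagonal.antidiagonal_zero, Finset.sum_singleton,
      prodMean_scaledStep W hφ hC]
    simp [prodMean, prodMeanDeriv]
  | succ N ih =>
    have hC0 : 0 ≤ C := (norm_nonneg _).trans (hC 0)
    set ψ : ℝ → ℂ := fun x => φ x * ∫ y, φ (y * x) ∂μ with hψdef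
    have hψ : Measurable ψ := hφ.mul (measurable_echo_average hφ)
    have hφD : ∀ x, ‖φ x‖ ≤ C + C * C := fun x => (hC x).trans (by nlinarith)
    have hψD : ∀ x, ‖ψ x‖ ≤ C + C * C := fun x => by
      rw [hψdef, norm_mul]
      have := mul_le_mul (hC x) (norm_echo_average_le (μ := μ) hC x) (norm_nonneg _) hC0
      linarith
    set Y : ℕ → Ω → ℝ := fun k ω => W.pureStep ω k
    have hY : ∀ n, HasDerivAt (fun t : ℝ => prodMean P Y (fun x => φ x + t * ψ x) n)
        (prodMeanDeriv P Y φ ψ n) 0 :=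
      hasDerivAt_prodMean P W.measurable_pureStep hφ hψ hφD hψD
    have hZ : ∀ n, HasDerivAt
        (fun t : ℝ => prodMean (μ.prod P) W.scaledStep (fun x => φ x + t * ψ x) n)
        (prodMeanDeriv (μ.prod P) W.scaledStep φ ψ n) 0 :=
      hasDerivAt_prodMean _ W.measurable_scaledStep hφ hψ hφD hψD
    -- The induction hypothesis holds for every φ + tψ. Comparing the derivatives of its two sides
    -- at t = 0 produces the identity for N + 1.
    have hl := (hY (N + 2)).const_mul ((N : ℂ) + 1)
    have hr := HasDerivAt.fun_sum (u := Finset.HasAntidiagonal.antidiagonal N)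
      fun ij _ => (hY (ij.1 + 1)).mul (hZ (ij.2 + 1))
    have heq : (fun t : ℝ => ((N : ℂ) + 1) * prodMean P Y (fun x => φ x + t * ψ x) (N + 2)) =
        fun t : ℝ => ∑ ij ∈ Finset.HasAntidiagonal.antidiagonal N,
          ((fun t : ℝ => prodMean P Y (fun x => φ x + t * ψ x) (ij.1 + 1)) *
          (fun t : ℝ => prodMean (μ.prod P) W.scaledStep (fun x => φ x + t * ψ x) (ij.2 + 1))) t := by
      funext t
      refine ih (hφ.add (hψ.const_mul _)) (C := C + C * C + |t| * (C + C * C)) fun x => ?_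
      refine (norm_add_le _ _).trans (add_le_add (hφD x) ?_)
      rw [norm_mul, Complex.norm_real, Real.norm_eq_abs]
      gcongr
      exact hψD x
    rw [heq] at hl
    have hd := hl.unique hr
    simp only [Complex.ofReal_zero, zero_mul, add_zero] at hd
    have hH : ∀ n : ℕ, prodMeanDeriv P Y φ ψ (n + 1) = (n + 1) * prodMean P Y φ (n + 2) :=
      W.prodMeanDeriv_echo hφ hC
    have hH' : ∀ n : ℕ, prodMeanDeriv (μ.prod P) W.scaledStep φ ψ (n + 1) =
        (n + 1) * prodMean (μ.prod P) W.scaledStep φ (n + 2) :=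
      W.prodMeanDeriv_scaledStep_echo hφ hC
    simp only [hH (N + 1), hH, hH', Nat.cast_add, Nat.cast_one] at hd
    -- Shift the first index in one sum and the second in the other: the added boundary terms carry
    -- a factor 0, and the weights i and j add up to N + 1 on the antidiagonal.
    have hkey : ∑ ij ∈ Finset.HasAntidiagonal.antidiagonal N,
        (((ij.1 : ℂ) + 1) * prodMean P Y φ (ij.1 + 2) *
          prodMean (μ.prod P) W.scaledStep φ (ij.2 + 1) +
        prodMean P Y φ (ij.1 + 1) *
          (((ij.2 : ℂ) + 1) * prodMean (μ.prod P) W.scaledStep φ (ij.2 + 2))) =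
        ((N : ℂ) + 1) * ∑ ij ∈ Finset.HasAntidiagonal.antidiagonal (N + 1), prodMean P Y φ (ij.1 + 1) *
          prodMean (μ.prod P) W.scaledStep φ (ij.2 + 1) := by
      have e1 := Finset.Nat.sum_antidiagonal_succ (n := N) (f := fun ij : ℕ × ℕ =>
        (ij.1 : ℂ) * prodMean P Y φ (ij.1 + 1) *
          prodMean (μ.prod P) W.scaledStep φ (ij.2 + 1))
      have e2 := Finset.Nat.sum_antidiagonal_succ' (n := N) (f := fun ij : ℕ × ℕ =>
        prodMean P Y φ (ij.1 + 1) *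
          ((ij.2 : ℂ) * prodMean (μ.prod P) W.scaledStep φ (ij.2 + 1)))
      simp only [Nat.cast_zero, zero_mul, mul_zero, zero_add, Nat.cast_add, Nat.cast_one] at e1 e2
      rw [Finset.sum_add_distrib, ← e1, ← e2, ← Finset.sum_add_distrib, Finset.mul_sum]
      refine Finset.sum_congr rfl fun ij hij => ?_
      have : (ij.1 : ℂ) + ij.2 = N + 1 := by exact_mod_cast Finset.HasAntidiagonal.mem_antidiagonal.1 hij
      rw [← this]
      ring
    rw [hkey] at hd
    have hN : ((N : ℂ) + 1) ≠ 0 := by exact_mod_cast N.succ_ne_zero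
    push_cast
    exact mul_left_cancel₀ hN hd

end RWES

/-! ### From multiplicative functionals to laws, by characteristic functions. -/

namespace RWES

variable {Ω : Type*} [mΩ : MeasurableSpace Ω] {P : Measure Ω} {p : ℝ} {ν μ : Measure ℝ}

/-- The sum of a walk of `i` steps and of an echo of an independent walk of `j` steps. -/
noncomputable def splitWalk (W : RWES P p ν μ) (i j : ℕ) (z : Ω × ℝ × Ω) : ℝ :=
  W.pureWalk i z.1 + z.2.1 * W.pureWalk j z.2.2

lemma measurable_splitWalk (W : RWES P p ν μ) (i j : ℕ) : Measurable (W.splitWalk i j) :=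
  ((W.measurable_pureWalk i).comp measurable_fst).add
    (measurable_snd.fst.mul ((W.measurable_pureWalk j).comp measurable_snd.snd))

/-- For φ(x) = exp(isx) the product over the increments is the exponential of the sum, so `prodMean`
becomes a characteristic function. -/
lemma integral_exp_splitWalk [IsProbabilityMeasure P] [IsProbabilityMeasure μ]
    (W : RWES P p ν μ) (i j : ℕ) (s : ℝ) :
    ∫ z, Complex.exp (s * W.splitWalk i j z * Complex.I) ∂(P.prod (μ.prod P)) =
      prodMean P (fun k ω => W.pureStep ω k) (fun x => Complex.exp (s * x * Complex.I)) i *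
        prodMean (μ.prod P) W.scaledStep (fun x => Complex.exp (s * x * Complex.I)) j := by
  rw [prodMean, prodMean, ← integral_prod_mul]
  refine integral_congr_ae (ae_of_all _ fun z => ?_)
  simp only
  rw [← Complex.exp_sum, ← Complex.exp_sum, ← Complex.exp_add]
  congr 1
  simp only [splitWalk, pureWalk, scaledStep, Finset.mul_sum, Complex.ofReal_add,
    Complex.ofReal_sum, mul_add, add_mul, Finset.sum_mul]

lemma integral_exp_pureWalk (W : RWES P p ν μ) (n : ℕ) (s : ℝ) :
    ∫ ω, Complex.exp (s * W.pureWalk n ω * Complex.I) ∂P =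
      prodMean P (fun k ω => W.pureStep ω k) (fun x => Complex.exp (s * x * Complex.I)) n := by
  refine integral_congr_ae (ae_of_all _ fun ω => ?_)
  simp only
  rw [← Complex.exp_sum]
  congr 1
  simp only [pureWalk, Finset.mul_sum, Complex.ofReal_sum, Finset.sum_mul]

theorem integral_exp_pureWalk_split [IsProbabilityMeasure P] [IsProbabilityMeasure μ]
    (W : RWES P p ν μ) (N : ℕ) (s : ℝ) :
    (N + 1) * ∫ ω, Complex.exp (s * W.pureWalk (N + 2) ω * Complex.I) ∂P =
      ∑ ij ∈ Finset.HasAntidiagonal.antidiagonal N,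
        ∫ z, Complex.exp (s * W.splitWalk (ij.1 + 1) (ij.2 + 1) z * Complex.I)
          ∂(P.prod (μ.prod P)) := by
  simp only [integral_exp_splitWalk, integral_exp_pureWalk]
  refine W.prodMean_split N (C := 1) (by fun_prop) fun x => ?_
  rw [← Complex.ofReal_mul, Complex.norm_exp_ofReal_mul_I]

/-- The law of the walk after `N + 2` steps is the average of the laws of the split walks. -/
theorem lintegral_pureWalk_split [IsProbabilityMeasure P] [IsProbabilityMeasure μ]
    (W : RWES P p ν μ) (N : ℕ) {f : ℝ → ℝ≥0∞} (hf : Measurable f) :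
    ((N : ℝ≥0∞) + 1) * ∫⁻ ω, f (W.pureWalk (N + 2) ω) ∂P =
      ∑ ij ∈ Finset.HasAntidiagonal.antidiagonal N,
        ∫⁻ z, f (W.splitWalk (ij.1 + 1) (ij.2 + 1) z) ∂(P.prod (μ.prod P)) := by
  -- Both sides are finite measures of mass N + 1. Writing the left one as a sum of N + 1 copies of
  -- the same law lets both be treated as finite sums when comparing characteristic functions.
  have hlaw : ∑ _k ∈ Finset.range (N + 1), P.map (W.pureWalk (N + 2)) =
      ∑ ij ∈ Finset.HasAntidiagonal.antidiagonal N,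
        (P.prod (μ.prod P)).map (W.splitWalk (ij.1 + 1) (ij.2 + 1)) := by
    have := Measure.isProbabilityMeasure_map (μ := P)
      (W.measurable_pureWalk (N + 2)).aemeasurable
    have hfin : ∀ ij : ℕ × ℕ,
        IsProbabilityMeasure ((P.prod (μ.prod P)).map (W.splitWalk (ij.1 + 1) (ij.2 + 1))) :=
      fun ij => Measure.isProbabilityMeasure_map (W.measurable_splitWalk _ _).aemeasurable
    refine Measure.ext_of_charFun (funext fun s => ?_)
    have hexp : Measurable fun x : ℝ => Complex.exp (s * x * Complex.I) := by fun_prop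
    have hint : ∀ (ρ : Measure ℝ) [IsFiniteMeasure ρ],
        Integrable (fun x : ℝ => Complex.exp (s * x * Complex.I)) ρ := fun ρ _ =>
      Integrable.of_bound hexp.aestronglyMeasurable 1 (ae_of_all _ fun x => by
        rw [← Complex.ofReal_mul, Complex.norm_exp_ofReal_mul_I])
    rw [charFun_apply_real, charFun_apply_real, integral_finsetSum_measure fun _ _ => hint _,
      integral_finsetSum_measure fun _ _ => hint _, Finset.sum_const, Finset.card_range,
      integral_map (W.measurable_pureWalk _).aemeasurable hexp.aestronglyMeasurable, nsmul_eq_mul]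
    push_cast
    rw [integral_exp_pureWalk_split]
    refine Finset.sum_congr rfl fun ij _ => ?_
    rw [integral_map (W.measurable_splitWalk _ _).aemeasurable hexp.aestronglyMeasurable]
  have h := congrArg (fun ρ => ∫⁻ x, f x ∂ρ) hlaw
  simp only [lintegral_finsetSum_measure, Finset.sum_const, Finset.card_range,
    lintegral_map hf (W.measurable_splitWalk _ _)] at h
  simpa [lintegral_map hf (W.measurable_pureWalk _)] using h

end RWES

/-! ### The martingale and the almost sure limit. -/

namespace RWES

variable {Ω : Type*} [mΩ : MeasurableSpace Ω] {P : Measure Ω} {p : ℝ} {ν μ : Measure ℝ}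

lemma echoMoment_one (μ : Measure ℝ) : echoMoment μ 1 = ∫ x, x ∂μ := by
  simp [echoMoment]

lemma integrable_ξ (W : RWES P p ν μ) (hμ : Integrable (fun x : ℝ => x) μ) (n : ℕ) :
    Integrable (W.ξ n) P := by
  rw [← W.law_ξ n] at hμ
  exact hμ.comp_measurable (W.measurable_ξ n)

lemma integrable_indicator_ξ (W : RWES P p ν μ) (hμ : Integrable (fun x : ℝ => x) μ) (n : ℕ)
    (j : Fin (n + 1)) : Integrable ((W.U n ⁻¹' {j}).indicator (W.ξ n)) P :=
  (W.integrable_ξ hμ n).indicator (W.measurable_U n (measurableSet_singleton j))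

lemma measurable_indicator_ξ (W : RWES P p ν μ) (n : ℕ) (j : Fin (n + 1)) :
    Measurable[MeasurableSpace.comap (fun ω => (W.U n ω, W.ξ n ω)) inferInstance]
      ((W.U n ⁻¹' {j}).indicator (W.ξ n)) := by
  have h : (W.U n ⁻¹' {j}).indicator (W.ξ n) =
      (fun z : Fin (n + 1) × ℝ => ((Prod.fst ⁻¹' {j} : Set (Fin (n + 1) × ℝ)).indicator
        (fun z => z.2) z)) ∘ fun ω => (W.U n ω, W.ξ n ω) := by
    funext ω
    simp [Set.indicator]
  rw [h]
  exact (measurable_snd.indicator (measurable_fst (measurableSet_singleton j))).comp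
    (comap_measurable _)

lemma integral_indicator_ξ [IsProbabilityMeasure P] (W : RWES P p ν μ) (n : ℕ)
    (j : Fin (n + 1)) :
    ∫ ω, (W.U n ⁻¹' {j}).indicator (W.ξ n) ω ∂P = echoMoment μ 1 / (n + 1) := by
  have h := (W.indepFun_U_ξ n).integral_fun_comp_mul_comp
    (f := ({j} : Set (Fin (n + 1))).indicator (fun _ => (1 : ℝ))) (g := fun x : ℝ => x)
    (W.measurable_U n).aemeasurable (W.measurable_ξ n).aemeasurable
    (measurable_of_finite _).aestronglyMeasurable measurable_id.aestronglyMeasurable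
  have h1 : ∫ ω, W.ξ n ω ∂P = echoMoment μ 1 := by
    have h0 := integral_map (W.measurable_ξ n).aemeasurable
      (measurable_id (α := ℝ)).aestronglyMeasurable (μ := P)
    rw [W.law_ξ n] at h0
    rw [echoMoment_one]
    exact h0.symm
  have h2 : ∫ ω, ({j} : Set (Fin (n + 1))).indicator (fun _ => (1 : ℝ)) (W.U n ω) ∂P =
      ((n : ℝ) + 1)⁻¹ := by
    rw [← W.map_U_real_singleton n j, ← integral_indicator_one (measurableSet_singleton j),
      integral_map (W.measurable_U n).aemeasurable
      (measurable_of_finite _).aestronglyMeasurable]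
    rfl
  rw [h1, h2] at h
  rw [div_eq_inv_mul, ← h]
  refine integral_congr_ae (ae_of_all _ fun ω => ?_)
  simp [Set.indicator]

lemma integrable_pureStep [IsProbabilityMeasure P] (W : RWES P p ν μ)
    (hμ : Integrable (fun x : ℝ => x) μ) (k : ℕ) : Integrable (fun ω => W.pureStep ω k) P := by
  induction k using Nat.strong_induction_on with
  | _ k ih =>
    cases k with
    | zero => simp
    | succ k =>
      simp only [pureStep_succ_eq_sum]
      refine integrable_finsetSum _ fun j _ => ?_
      refine IndepFun.integrable_mul ?_ (ih j (by omega)) (W.integrable_indicator_ξ hμ k j)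
      rw [IndepFun_iff_Indep]
      refine Indep.symm (indep_of_indep_of_le_left (indep_of_indep_of_le_right
        (W.indep_filtration k) ?_) (W.measurable_indicator_ξ k j).comap_le)
      exact (W.measurable_filtration_pureStep (Nat.lt_succ_iff.1 j.isLt)).comap_le

lemma integrable_pureWalk [IsProbabilityMeasure P] (W : RWES P p ν μ)
    (hμ : Integrable (fun x : ℝ => x) μ) (n : ℕ) : Integrable (W.pureWalk n) P :=
  integrable_finsetSum _ fun k _ => W.integrable_pureStep hμ k

/-- Given the past, each of the n + 1 earlier increments is echoed with probability 1/(n+1), by a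
factor of mean m_1 independent of the past. -/
lemma condExp_pureStep [IsProbabilityMeasure P] (W : RWES P p ν μ)
    (hμ : Integrable (fun x : ℝ => x) μ) (n : ℕ) :
    P[fun ω => W.pureStep ω (n + 1) | W.filtration n] =ᵐ[P]
      fun ω => echoMoment μ 1 / (n + 1) * W.pureWalk (n + 1) ω := by
  have hprod : ∀ j : Fin (n + 1), Integrable ((fun ω => W.pureStep ω j) *
      (W.U n ⁻¹' {j}).indicator (W.ξ n)) P := by
    intro j
    refine IndepFun.integrable_mul ?_ (W.integrable_pureStep hμ j) (W.integrable_indicator_ξ hμ n j)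
    rw [IndepFun_iff_Indep]
    refine Indep.symm (indep_of_indep_of_le_left (indep_of_indep_of_le_right
      (W.indep_filtration n) ?_) (W.measurable_indicator_ξ n j).comap_le)
    exact (W.measurable_filtration_pureStep (Nat.lt_succ_iff.1 j.isLt)).comap_le
  have heq : (fun ω => W.pureStep ω (n + 1)) = ∑ j : Fin (n + 1),
      (fun ω => W.pureStep ω j) * (W.U n ⁻¹' {j}).indicator (W.ξ n) := by
    funext ω
    rw [pureStep_succ_eq_sum]
    simp
  have hle : MeasurableSpace.comap (fun ω => (W.U n ω, W.ξ n ω)) inferInstance ≤ mΩ :=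
    ((W.measurable_U n).prodMk (W.measurable_ξ n)).comap_le
  have hj : ∀ j : Fin (n + 1), P[(fun ω => W.pureStep ω j) *
      (W.U n ⁻¹' {j}).indicator (W.ξ n) | W.filtration n] =ᵐ[P]
      fun ω => W.pureStep ω j * (echoMoment μ 1 / (n + 1)) := by
    intro j
    have h1 := condExp_mul_of_stronglyMeasurable_left
      (W.measurable_filtration_pureStep (Nat.lt_succ_iff.1 j.isLt)).stronglyMeasurable
      (hprod j) (W.integrable_indicator_ξ hμ n j)
    have h2 := condExp_indep_eq hle (W.filtration.le n)
      (W.measurable_indicator_ξ n j).stronglyMeasurable (W.indep_filtration n)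
    filter_upwards [h1, h2] with ω h1 h2
    rw [h1, Pi.mul_apply, h2, W.integral_indicator_ξ]
  rw [heq]
  refine (condExp_finsetSum (fun j _ => hprod j) _).trans ?_
  filter_upwards [ae_all_iff.2 hj] with ω h
  rw [Finset.sum_apply, Finset.sum_congr rfl fun j _ => h j, ← Finset.sum_mul, mul_comm, pureWalk,
    Fin.sum_univ_eq_sum_range (fun k => W.pureStep ω k)]

/-- The mean of the pure walk after `n + 1` steps. -/
noncomputable def meanWalk (m : ℝ) (n : ℕ) : ℝ := ∏ k ∈ Finset.range n, (1 + m / (k + 1))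

lemma meanWalk_pos {m : ℝ} (hm : 0 ≤ m) (n : ℕ) : 0 < meanWalk m n :=
  Finset.prod_pos fun k _ => by positivity

lemma meanWalk_succ (m : ℝ) (n : ℕ) : meanWalk m (n + 1) = meanWalk m n * (1 + m / (n + 1)) :=
  Finset.prod_range_succ _ _

/-- The mean is m(m+1)⋯(m+n) / (m n!), essentially the reciprocal of Euler's sequence for Γ(m). -/
lemma meanWalk_mul_GammaSeq {m : ℝ} (hm : 0 < m) (n : ℕ) :
    m * meanWalk m n * Real.GammaSeq m n = (n : ℝ) ^ m := by
  have h : ∏ j ∈ Finset.range (n + 1), (m + j) = m * meanWalk m n * n.factorial := by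
    induction n with
    | zero => simp [meanWalk]
    | succ n ih =>
      rw [Finset.prod_range_succ, ih, meanWalk_succ, Nat.factorial_succ]
      push_cast
      field_simp
      ring
  have h1 := meanWalk_pos hm.le n
  have h2 : (0 : ℝ) < n.factorial := by exact_mod_cast n.factorial_pos
  rw [Real.GammaSeq, h]
  field_simp

lemma tendsto_meanWalk_div_rpow {m : ℝ} (hm : 0 < m) :
    Tendsto (fun n : ℕ => meanWalk m n / ((n + 1 : ℕ) : ℝ) ^ m) atTop
      (𝓝 (1 / Real.Gamma (1 + m))) := by
  have hG : 0 < Real.Gamma (1 + m) := Real.Gamma_pos_of_pos (by linarith)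
  have h1 : Tendsto (fun n : ℕ => m * Real.GammaSeq m n) atTop (𝓝 (Real.Gamma (1 + m))) := by
    rw [add_comm, Real.Gamma_add_one hm.ne']
    exact (Real.GammaSeq_tendsto_Gamma m).const_mul m
  -- Euler's sequence involves n^m, whereas `meanWalk m n` is the mean after n + 1 steps; this
  -- factor corrects the shift.
  have h2 : Tendsto (fun n : ℕ => (((n : ℝ) / (n + 1)) ^ m)) atTop (𝓝 1) := by
    have := (tendsto_natCast_div_add_atTop (1 : ℝ)).rpow_const (p := m) (Or.inl one_ne_zero)
    simpa using this
  refine (h2.div h1 hG.ne').congr' ?_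
  filter_upwards [eventually_gt_atTop 0] with n hn
  have hn' : (0 : ℝ) < n := by exact_mod_cast hn
  have h3 := meanWalk_mul_GammaSeq hm n
  have h4 : 0 < (n : ℝ) ^ m := Real.rpow_pos_of_pos hn' m
  have h5 : 0 < m * Real.GammaSeq m n := by
    have := meanWalk_pos hm.le n
    by_contra hc
    nlinarith
  have h6 : (0 : ℝ) < ((n : ℝ) + 1) ^ m := by positivity
  simp only [Pi.div_apply]
  rw [Real.div_rpow hn'.le (by positivity)]
  push_cast
  rw [div_div, div_eq_div_iff (by positivity) h6.ne', ← h3]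
  ring

/-- The walk divided by its mean. -/
noncomputable def normWalk (W : RWES P p ν μ) (n : ℕ) (ω : Ω) : ℝ :=
  W.pureWalk (n + 1) ω / meanWalk (echoMoment μ 1) n

lemma echoMoment_nonneg (hμ0 : ∀ᵐ x ∂μ, 0 ≤ x) (γ : ℝ) : 0 ≤ echoMoment μ γ :=
  integral_nonneg_of_ae (hμ0.mono fun _ hx => Real.rpow_nonneg hx γ)

lemma martingale_normWalk [IsProbabilityMeasure P] (W : RWES P p ν μ)
    (hμ0 : ∀ᵐ x ∂μ, 0 ≤ x) (hμ : Integrable (fun x : ℝ => x) μ) :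
    Martingale W.normWalk W.filtration P := by
  have hm := echoMoment_nonneg hμ0 1
  refine martingale_nat ?_ ?_ ?_
  · exact fun n => ((W.measurable_filtration_pureWalk n).div_const _).stronglyMeasurable
  · exact fun n => (W.integrable_pureWalk hμ _).div_const _
  · intro n
    have h1 : W.normWalk (n + 1) = (meanWalk (echoMoment μ 1) (n + 1))⁻¹ •
        (W.pureWalk (n + 1) + fun ω => W.pureStep ω (n + 1)) := by
      funext ω
      simp [normWalk, pureWalk_succ _ (n + 1), div_eq_inv_mul]
    rw [h1]
    have h2 := condExp_smul (μ := P) (m := W.filtration n)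
      (meanWalk (echoMoment μ 1) (n + 1))⁻¹
      (W.pureWalk (n + 1) + fun ω => W.pureStep ω (n + 1))
    have h3 := condExp_add (μ := P) (W.integrable_pureWalk hμ (n + 1))
      (W.integrable_pureStep hμ (n + 1)) (W.filtration n)
    have h4 := condExp_of_stronglyMeasurable (μ := P) (W.filtration.le n)
      (W.measurable_filtration_pureWalk n).stronglyMeasurable (W.integrable_pureWalk hμ (n + 1))
    filter_upwards [h2, h3, W.condExp_pureStep hμ n] with ω h2 h3 h5
    rw [h2, Pi.smul_apply, h3, Pi.add_apply, h4, h5, normWalk, meanWalk_succ]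
    have ha := meanWalk_pos hm n
    simp only [smul_eq_mul]
    field_simp

lemma integral_normWalk [IsProbabilityMeasure P] (W : RWES P p ν μ)
    (hμ0 : ∀ᵐ x ∂μ, 0 ≤ x) (hμ : Integrable (fun x : ℝ => x) μ) (n : ℕ) :
    ∫ ω, W.normWalk n ω ∂P = 1 := by
  have h := (W.martingale_normWalk hμ0 hμ).setIntegral_eq (Nat.zero_le n) MeasurableSet.univ
  rw [setIntegral_univ, setIntegral_univ] at h
  rw [← h]
  simp [normWalk, meanWalk]

lemma ae_normWalk_nonneg (W : RWES P p ν μ) (hμ0 : ∀ᵐ x ∂μ, 0 ≤ x) :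
    ∀ᵐ ω ∂P, ∀ n, 0 ≤ W.normWalk n ω := by
  filter_upwards [W.ae_pureWalk_nonneg hμ0] with ω h n
  exact div_nonneg (h _) (meanWalk_pos (echoMoment_nonneg hμ0 1) n).le

lemma eLpNorm_one_normWalk [IsProbabilityMeasure P] (W : RWES P p ν μ)
    (hμ0 : ∀ᵐ x ∂μ, 0 ≤ x) (hμ : Integrable (fun x : ℝ => x) μ) (n : ℕ) :
    eLpNorm (W.normWalk n) 1 P ≤ ((1 : NNReal) : ℝ≥0∞) := by
  rw [eLpNorm_one_eq_lintegral_enorm,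
    ← ofReal_integral_norm_eq_lintegral_enorm ((W.martingale_normWalk hμ0 hμ).integrable n),
    integral_congr_ae (g := W.normWalk n), W.integral_normWalk hμ0 hμ n]
  · simp
  · filter_upwards [W.ae_normWalk_nonneg hμ0] with ω h
    exact Real.norm_of_nonneg (h n)

/-- The almost sure limit of the walk after `n` steps divided by `n ^ m_1`. -/
noncomputable def limitWalk (W : RWES P p ν μ) (ω : Ω) : ℝ :=
  Filtration.limitProcess W.normWalk W.filtration P ω / Real.Gamma (1 + echoMoment μ 1)

lemma measurable_limitWalk (W : RWES P p ν μ) : Measurable W.limitWalk :=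
  (Filtration.stronglyMeasurable_limit_process'.measurable).div_const _

lemma integrable_limitWalk [IsProbabilityMeasure P] (W : RWES P p ν μ)
    (hμ0 : ∀ᵐ x ∂μ, 0 ≤ x) (hμ : Integrable (fun x : ℝ => x) μ) : Integrable W.limitWalk P :=
  (memLp_one_iff_integrable.1 (Submartingale.memLp_limitProcess
    (W.martingale_normWalk hμ0 hμ).submartingale (W.eLpNorm_one_normWalk hμ0 hμ))).div_const _

/-- Martingale convergence applies because a nonnegative martingale with mean 1 is bounded in L^1;
multiplying by the asymptotics of the mean changes the normalization to n^m. -/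
theorem ae_tendsto_limitWalk [IsProbabilityMeasure P] (W : RWES P p ν μ)
    (hμ0 : ∀ᵐ x ∂μ, 0 ≤ x) (hμ : Integrable (fun x : ℝ => x) μ) (hm : 0 < echoMoment μ 1) :
    ∀ᵐ ω ∂P, Tendsto (fun n : ℕ => W.pureWalk n ω / (n : ℝ) ^ echoMoment μ 1) atTop
      (𝓝 (W.limitWalk ω)) := by
  filter_upwards [Submartingale.ae_tendsto_limitProcess
    (W.martingale_normWalk hμ0 hμ).submartingale (W.eLpNorm_one_normWalk hμ0 hμ)] with ω h
  refine (tendsto_add_atTop_iff_nat 1).1 ?_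
  have h2 := h.mul (tendsto_meanWalk_div_rpow hm)
  rw [mul_one_div] at h2
  refine h2.congr fun n => ?_
  have := (meanWalk_pos hm.le n).ne'
  rw [normWalk]
  field_simp

lemma ae_limitWalk_nonneg [IsProbabilityMeasure P] (W : RWES P p ν μ)
    (hμ0 : ∀ᵐ x ∂μ, 0 ≤ x) (hμ : Integrable (fun x : ℝ => x) μ) (hm : 0 < echoMoment μ 1) :
    ∀ᵐ ω ∂P, 0 ≤ W.limitWalk ω := by
  filter_upwards [W.ae_tendsto_limitWalk hμ0 hμ hm, W.ae_pureWalk_nonneg hμ0] with ω h1 h2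
  exact ge_of_tendsto' h1 fun n => div_nonneg (h2 n) (by positivity)

end RWES

/-! ### Convergence of martingales in L^γ. -/

section LpMartingale

variable {Ω : Type*} {mΩ : MeasurableSpace Ω} {P : Measure Ω}

lemma eLpNorm_ofReal_eq {f : Ω → ℝ} {γ : ℝ} (hγ : 0 < γ) :
    eLpNorm f (ENNReal.ofReal γ) P = (∫⁻ ω, ‖f ω‖ₑ ^ γ ∂P) ^ (1 / γ) := by
  rw [eLpNorm_eq_lintegral_rpow_enorm_toReal (by simpa using hγ) ENNReal.ofReal_ne_top,
    ENNReal.toReal_ofReal hγ.le]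

/-- From |f|^γ ≤ K^(γ-1) |f|. It upgrades L^1 convergence to L^γ convergence for uniformly bounded
functions. -/
lemma eLpNorm_ofReal_le_of_bound {f : Ω → ℝ} {γ K : ℝ} (hγ : 1 ≤ γ)
    (hf : ∀ᵐ ω ∂P, |f ω| ≤ K) :
    eLpNorm f (ENNReal.ofReal γ) P ≤ (ENNReal.ofReal (K ^ (γ - 1)) * eLpNorm f 1 P) ^ (1 / γ) := by
  rw [eLpNorm_ofReal_eq (by linarith), eLpNorm_one_eq_lintegral_enorm,
    ← lintegral_const_mul' _ _ ENNReal.ofReal_ne_top]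
  refine ENNReal.rpow_le_rpow (lintegral_mono_ae ?_) (by positivity)
  filter_upwards [hf] with ω h
  rw [Real.enorm_eq_ofReal_abs, ENNReal.ofReal_rpow_of_nonneg (abs_nonneg _) (by linarith),
    ← ENNReal.ofReal_mul' (abs_nonneg _)]
  refine ENNReal.ofReal_le_ofReal ?_
  rcases (abs_nonneg (f ω)).eq_or_lt with h0 | h0
  · rw [← h0, Real.zero_rpow (by linarith), mul_zero]
  · calc |f ω| ^ γ = |f ω| ^ (γ - 1) * |f ω| := by
          rw [Real.rpow_sub_one h0.ne', div_mul_cancel₀ _ h0.ne']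
      _ ≤ K ^ (γ - 1) * |f ω| := by
          gcongr

/-- The sigma-algebra is left arbitrary so that the approximation can be carried out on a trimmed
measure, which keeps h measurable for the smaller sigma-algebra. -/
lemma exists_bounded_eLpNorm_sub_lt {m : MeasurableSpace Ω} {Q : Measure Ω} {g : Ω → ℝ}
    {q : ℝ≥0∞} (hg : MemLp g q Q) (hq : q ≠ ∞) {ε : ℝ≥0∞} (hε : ε ≠ 0) :
    ∃ h : Ω → ℝ, StronglyMeasurable h ∧ (∃ K : NNReal, ∀ ω, |h ω| ≤ K) ∧
      eLpNorm (g - h) q Q < ε ∧ MemLp h q Q := by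
  obtain ⟨h, hh, hhL⟩ := hg.exists_simpleFunc_eLpNorm_sub_lt hq hε
  obtain ⟨C, hC⟩ := h.exists_forall_norm_le
  exact ⟨h, h.stronglyMeasurable,
    ⟨C.toNNReal, fun ω => (hC ω).trans (Real.le_coe_toNNReal C)⟩, hh, hhL⟩

lemma uniformIntegrable_of_eLpNorm_bdd [IsFiniteMeasure P] {f : ℕ → Ω → ℝ} {γ : ℝ} (hγ : 1 < γ)
    (hf : ∀ n, AEStronglyMeasurable (f n) P) {R : NNReal}
    (hR : ∀ n, eLpNorm (f n) (ENNReal.ofReal γ) P ≤ R) : UniformIntegrable f 1 P := by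
  refine uniformIntegrable_of le_rfl ENNReal.one_ne_top hf fun ε hε => ?_
  -- On {|f| ≥ C} one has |f| ≤ C^(1-γ) |f|^γ, so the tail has mass at most C^(1-γ) R^γ. The choice
  -- of C makes C^(1-γ) = 1/A, and the summand 1 keeps A positive when R = 0.
  set A : ℝ := (R : ℝ) ^ γ / ε + 1 with hA
  have hA0 : 0 < A := by positivity
  set C : ℝ := A ^ (1 / (γ - 1)) with hC
  have hC0 : 0 < C := Real.rpow_pos_of_pos hA0 _
  refine ⟨⟨C, hC0.le⟩, fun n => ?_⟩
  have hCpow : C ^ (1 - γ) = A⁻¹ := by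
    rw [hC, ← Real.rpow_mul hA0.le, ← Real.rpow_neg_one]
    congr 1
    have : γ - 1 ≠ 0 := by linarith
    field_simp
    ring
  have hint : ∫⁻ ω, ‖f n ω‖ₑ ^ γ ∂P ≤ ENNReal.ofReal ((R : ℝ) ^ γ) := by
    have h := hR n
    rw [eLpNorm_ofReal_eq (by linarith), one_div] at h
    have := (ENNReal.rpow_inv_le_iff (by linarith)).1 h
    rwa [← ENNReal.ofReal_coe_nnreal, ENNReal.ofReal_rpow_of_nonneg R.coe_nonneg (by linarith)]
      at this
  rw [eLpNorm_one_eq_lintegral_enorm]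
  calc ∫⁻ ω, ‖({x | (⟨C, hC0.le⟩ : NNReal) ≤ ‖f n x‖₊}.indicator (f n)) ω‖ₑ ∂P
      ≤ ∫⁻ ω, ENNReal.ofReal (C ^ (1 - γ)) * ‖f n ω‖ₑ ^ γ ∂P := by
        refine lintegral_mono fun ω => ?_
        by_cases h : (⟨C, hC0.le⟩ : NNReal) ≤ ‖f n ω‖₊
        · rw [Set.indicator_of_mem (by exact h), Real.enorm_eq_ofReal_abs,
            ENNReal.ofReal_rpow_of_nonneg (abs_nonneg _) (by linarith),
            ← ENNReal.ofReal_mul (by positivity)]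
          refine ENNReal.ofReal_le_ofReal ?_
          have h' : C ≤ |f n ω| := h
          have h0 : 0 < |f n ω| := hC0.trans_le h'
          calc |f n ω| = |f n ω| ^ (1 - γ) * |f n ω| ^ γ := by
                rw [← Real.rpow_add h0]; simp
            _ ≤ C ^ (1 - γ) * |f n ω| ^ γ := by
                gcongr ?_ * _
                exact Real.rpow_le_rpow_of_nonpos hC0 h' (by linarith)
        · rw [Set.indicator_of_notMem (by exact h)]
          simp
    _ = ENNReal.ofReal (C ^ (1 - γ)) * ∫⁻ ω, ‖f n ω‖ₑ ^ γ ∂P :=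
        lintegral_const_mul' _ _ ENNReal.ofReal_ne_top
    _ ≤ ENNReal.ofReal (C ^ (1 - γ)) * ENNReal.ofReal ((R : ℝ) ^ γ) := by gcongr
    _ ≤ ENNReal.ofReal ε := by
        rw [← ENNReal.ofReal_mul (by positivity), hCpow]
        refine ENNReal.ofReal_le_ofReal ?_
        rw [inv_mul_le_iff₀ hA0, hA]
        have : (0 : ℝ) ≤ (R : ℝ) ^ γ := by positivity
        field_simp
        linarith

/-- Lévy's upward theorem in `L^γ`. -/
theorem tendsto_eLpNorm_condExp_ofReal [IsProbabilityMeasure P] {ℱ : Filtration ℕ mΩ} {g : Ω → ℝ}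
    {γ : ℝ} (hγ : 1 ≤ γ) (hg : MemLp g (ENNReal.ofReal γ) P)
    (hgm : StronglyMeasurable[⨆ n, ℱ n] g) :
    Tendsto (fun n => eLpNorm (P[g | ℱ n] - g) (ENNReal.ofReal γ) P) atTop (𝓝 0) := by
  have hp : 1 ≤ ENNReal.ofReal γ := by simpa using ENNReal.ofReal_le_ofReal hγ
  have hle : (⨆ n, ℱ n) ≤ mΩ := iSup_le ℱ.le
  rw [ENNReal.tendsto_nhds_zero]
  intro ε hε
  have hε3 : ε / 3 ≠ 0 := by simpa using hε.ne'
  -- Approximating on the trimmed space gives a bounded h measurable for `⨆ n, ℱ n`, to which the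
  -- L^1 form of Lévy's theorem applies.
  have hgt : MemLp g (ENNReal.ofReal γ) (P.trim hle) :=
    ⟨hgm.aestronglyMeasurable, (eLpNorm_trim hle hgm).trans_lt hg.2⟩
  obtain ⟨h, hhm, ⟨K, hK⟩, hh, hhL⟩ :=
    exists_bounded_eLpNorm_sub_lt hgt ENNReal.ofReal_ne_top hε3
  rw [eLpNorm_trim hle (hgm.sub hhm)] at hh
  have hhP : MemLp h (ENNReal.ofReal γ) P := memLp_of_memLp_trim hle hhL
  have hlim : Tendsto (fun n => eLpNorm (P[h | ℱ n] - h) (ENNReal.ofReal γ) P) atTop (𝓝 0) := by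
    have h1 := Integrable.tendsto_eLpNorm_condExp (ℱ := ℱ) (hhP.integrable hp) hhm
    have h2 : Tendsto (fun n => (ENNReal.ofReal ((K + K : ℝ) ^ (γ - 1)) *
        eLpNorm (P[h | ℱ n] - h) 1 P) ^ (1 / γ)) atTop (𝓝 0) := by
      have h3 := ENNReal.Tendsto.const_mul h1
        (Or.inr (ENNReal.ofReal_ne_top (r := (K + K : ℝ) ^ (γ - 1))))
      rw [mul_zero] at h3
      have h4 := h3.ennrpow_const (1 / γ)
      rwa [ENNReal.zero_rpow_of_pos (by positivity)] at h4
    refine tendsto_of_tendsto_of_tendsto_of_le_of_le tendsto_const_nhds h2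
      (fun _ => zero_le) fun n => eLpNorm_ofReal_le_of_bound hγ ?_
    filter_upwards [ae_bdd_abs_condExp_of_ae_bdd_abs (m := ℱ n) (ae_of_all P hK)] with ω h5
    exact (abs_sub _ _).trans (add_le_add h5 (hK ω))
  filter_upwards [ENNReal.tendsto_nhds_zero.1 hlim (ε / 3) (pos_iff_ne_zero.2 hε3)] with n hn
  have hgi := hg.integrable hp
  have hhi := hhP.integrable hp
  -- Three-term splitting: the first term is controlled by contractivity of conditional expectation,
  -- the second by the bounded case, the third by the choice of h.
  have heq : P[g | ℱ n] - g =ᵐ[P] P[g - h | ℱ n] + ((P[h | ℱ n] - h) + (h - g)) := by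
    filter_upwards [condExp_sub hgi hhi (ℱ n)] with ω hω
    simp only [Pi.add_apply, Pi.sub_apply] at hω ⊢
    rw [hω]
    ring
  have hsm : ∀ f : Ω → ℝ, AEStronglyMeasurable (P[f | ℱ n]) P := fun f =>
    (stronglyMeasurable_condExp.mono (ℱ.le n)).aestronglyMeasurable
  rw [eLpNorm_congr_ae heq]
  refine (eLpNorm_add_le (hsm _) (((hsm _).sub hhP.1).add (hhP.1.sub hg.1)) hp).trans ?_
  refine (add_le_add (eLpNorm_condExp_le_eLpNorm _ hp)
    (eLpNorm_add_le ((hsm _).sub hhP.1) (hhP.1.sub hg.1) hp)).trans ?_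
  rw [eLpNorm_sub_comm h g]
  calc eLpNorm (g - h) (ENNReal.ofReal γ) P + (eLpNorm (P[h | ℱ n] - h) (ENNReal.ofReal γ) P +
        eLpNorm (g - h) (ENNReal.ofReal γ) P) ≤ ε / 3 + (ε / 3 + ε / 3) :=
        add_le_add hh.le (add_le_add hn hh.le)
    _ = ε := by rw [← add_assoc, ENNReal.add_thirds]

/-- A martingale bounded in `L^γ`, `γ > 1`, converges in `L^γ`. -/
theorem Martingale.tendsto_eLpNorm_limitProcess [IsProbabilityMeasure P] {ℱ : Filtration ℕ mΩ}
    {f : ℕ → Ω → ℝ} (hf : Martingale f ℱ P) {γ : ℝ} (hγ : 1 < γ) {R : NNReal}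
    (hR : ∀ n, eLpNorm (f n) (ENNReal.ofReal γ) P ≤ R) :
    MemLp (Filtration.limitProcess f ℱ P) (ENNReal.ofReal γ) P ∧
    Tendsto (fun n => eLpNorm (f n - Filtration.limitProcess f ℱ P) (ENNReal.ofReal γ) P)
      atTop (𝓝 0) ∧
    ∫ ω, Filtration.limitProcess f ℱ P ω ∂P = ∫ ω, f 0 ω ∂P := by
  have hmeas : ∀ n, AEStronglyMeasurable (f n) P := fun n => (hf.integrable n).1
  have hUI := uniformIntegrable_of_eLpNorm_bdd hγ hmeas hR
  have hmem := hf.submartingale.memLp_limitProcess hR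
  have hce := hf.ae_eq_condExp_limitProcess hUI
  refine ⟨hmem, ?_, ?_⟩
  · refine (tendsto_eLpNorm_condExp_ofReal hγ.le hmem
      Filtration.stronglyMeasurable_limitProcess).congr fun n => ?_
    exact eLpNorm_congr_ae ((hce n).symm.sub EventuallyEq.rfl)
  · rw [integral_congr_ae (hce 0), integral_condExp (ℱ.le 0)]

end LpMartingale

/-! ### Passage to the limit in the branching identity: the smoothing equation. -/

/-- The average of finitely many values as an integral over the unit interval. -/
lemma average_range_eq_integral (N : ℕ) (h : ℕ → ℂ) :
    ((N : ℂ) + 1)⁻¹ * ∑ k ∈ Finset.range (N + 1), h k =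
      ∫ u in Set.Ioo (0 : ℝ) 1, h ⌊((N : ℝ) + 1) * u⌋₊ := by
  have hcell : ∀ k : ℕ, ∀ᵐ x : ℝ, x ∈ Set.uIoc (k : ℝ) ((k + 1 : ℕ) : ℝ) → h ⌊x⌋₊ = h k := by
    intro k
    -- The floor is k on [k, k+1), while interval integrals use (k, k+1]; only the right endpoint
    -- has to be discarded.
    have : ∀ᵐ x : ℝ, x ≠ (k : ℝ) + 1 := by simp [ae_iff]
    filter_upwards [this] with x hx hxk
    rw [Set.uIoc_of_le (by simp)] at hxk
    push_cast at hxk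
    rw [(Nat.floor_eq_iff (by linarith [hxk.1, k.cast_nonneg (α := ℝ)])).2
      ⟨hxk.1.le, lt_of_le_of_ne hxk.2 hx⟩]
  have hint : ∀ k < N + 1, IntervalIntegrable (fun x : ℝ => h ⌊x⌋₊) volume (k : ℝ)
      ((k + 1 : ℕ) : ℝ) := by
    intro k _
    refine (intervalIntegrable_const (c := h k)).congr_ae ?_
    refine (ae_restrict_iff' measurableSet_uIoc).2 ?_
    filter_upwards [hcell k] with x hx hxk
    exact (hx hxk).symm
  have h1 := intervalIntegral.sum_integral_adjacent_intervals hint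
  have h2 : ∀ k : ℕ, ∫ x in (k : ℝ)..((k + 1 : ℕ) : ℝ), h ⌊x⌋₊ = h k := by
    intro k
    rw [intervalIntegral.integral_congr_ae (hcell k)]
    simp
  simp only [h2] at h1
  have h3 := intervalIntegral.integral_comp_mul_left (a := 0) (b := 1) (fun x : ℝ => h ⌊x⌋₊)
    (c := (N : ℝ) + 1) (by positivity)
  rw [← integral_Ioc_eq_integral_Ioo, ← intervalIntegral.integral_of_le zero_le_one, h3, h1]
  push_cast
  simp

/-- With ⌊(N+1)u⌋ as the uniform index, this is the proportion of the N + 2 steps that falls in the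
first subtree. -/
lemma tendsto_floor_add_one_div {u : ℝ} (hu : 0 ≤ u) :
    Tendsto (fun N : ℕ => ((⌊((N : ℝ) + 1) * u⌋₊ : ℝ) + 1) / (N + 2)) atTop (𝓝 u) := by
  have h1 : Tendsto (fun N : ℕ => (N : ℝ) + 1) atTop atTop :=
    tendsto_atTop_add_const_right _ _ tendsto_natCast_atTop_atTop
  have h2 : Tendsto (fun N : ℕ => (N : ℝ) + 2) atTop atTop :=
    tendsto_atTop_add_const_right _ _ tendsto_natCast_atTop_atTop
  have h3 := (tendsto_nat_floor_mul_div_atTop hu).comp h1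
  have h4 : Tendsto (fun N : ℕ => ((N : ℝ) + 2)⁻¹) atTop (𝓝 0) := tendsto_inv_atTop_zero.comp h2
  have h5 := (h3.mul (h4.const_sub 1)).add h4
  rw [sub_zero, mul_one, add_zero] at h5
  refine h5.congr fun N => ?_
  simp only [Function.comp_apply, mul_comm u]
  have : (N : ℝ) + 1 ≠ 0 := by positivity
  have : (N : ℝ) + 2 ≠ 0 := by positivity
  field_simp
  ring

lemma floor_mul_le {u : ℝ} (hu : u ∈ Set.Ioo (0 : ℝ) 1) (N : ℕ) : ⌊((N : ℝ) + 1) * u⌋₊ ≤ N := by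
  refine Nat.lt_succ_iff.1 ((Nat.floor_lt (by have := hu.1; positivity)).2 ?_)
  push_cast
  nlinarith [hu.2, N.cast_nonneg (α := ℝ)]

lemma tendsto_floor_sub_add_one_div {u : ℝ} (hu : u ∈ Set.Ioo (0 : ℝ) 1) :
    Tendsto (fun N : ℕ => (((N - ⌊((N : ℝ) + 1) * u⌋₊ : ℕ) : ℝ) + 1) / (N + 2)) atTop
      (𝓝 (1 - u)) := by
  refine ((tendsto_floor_add_one_div hu.1.le).const_sub 1).congr fun N => ?_
  rw [Nat.cast_sub (floor_mul_le hu N)]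
  have : (N : ℝ) + 2 ≠ 0 := by positivity
  field_simp
  ring

lemma tendsto_atTop_of_tendsto_add_one_div {k : ℕ → ℕ} {u : ℝ} (hu : 0 < u)
    (h : Tendsto (fun N : ℕ => ((k N : ℝ) + 1) / (N + 2)) atTop (𝓝 u)) :
    Tendsto (fun N => k N + 1) atTop atTop := by
  have h2 : Tendsto (fun N : ℕ => (N : ℝ) + 2) atTop atTop :=
    tendsto_atTop_add_const_right _ _ tendsto_natCast_atTop_atTop
  have h3 := h.pos_mul_atTop hu h2
  refine tendsto_natCast_atTop_iff.1 (h3.congr fun N => ?_)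
  have : (N : ℝ) + 2 ≠ 0 := by positivity
  push_cast
  field_simp

lemma tendsto_div_rpow_of_tendsto_div {S : ℕ → ℝ} {m l u : ℝ} {k : ℕ → ℕ} (hu : 0 < u)
    (hS : Tendsto (fun n : ℕ => S n / (n : ℝ) ^ m) atTop (𝓝 l))
    (h : Tendsto (fun N : ℕ => ((k N : ℝ) + 1) / (N + 2)) atTop (𝓝 u)) :
    Tendsto (fun N : ℕ => S (k N + 1) / ((N : ℝ) + 2) ^ m) atTop (𝓝 (u ^ m * l)) := by
  have h1 := hS.comp (tendsto_atTop_of_tendsto_add_one_div hu h)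
  have h2 := h.rpow_const (p := m) (Or.inl hu.ne')
  refine (h2.mul h1).congr fun N => ?_
  simp only [Function.comp_apply]
  have h3 : (0 : ℝ) < ((k N : ℝ) + 1) ^ m := by positivity
  rw [Real.div_rpow (by positivity) (by positivity)]
  push_cast
  field_simp

namespace RWES

variable {Ω : Type*} [mΩ : MeasurableSpace Ω] {P : Measure Ω} {p : ℝ} {ν μ : Measure ℝ}

/-- The right-hand side of the smoothing equation `L = u ^ m L' + (1 - u) ^ m ξ L''`. -/
noncomputable def smoothing (W : RWES P p ν μ) (z : ℝ × Ω × ℝ × Ω) : ℝ :=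
  z.1 ^ echoMoment μ 1 * W.limitWalk z.2.1 +
    z.2.2.1 * ((1 - z.1) ^ echoMoment μ 1 * W.limitWalk z.2.2.2)

lemma measurable_smoothing (W : RWES P p ν μ) : Measurable W.smoothing := by
  have := W.measurable_limitWalk
  unfold smoothing
  fun_prop

/-- The law of the uniform variable, the two limits and the echo in the smoothing equation. -/
noncomputable abbrev smoothingLaw (P : Measure Ω) (μ : Measure ℝ) : Measure (ℝ × Ω × ℝ × Ω) :=
  (volume.restrict (Set.Ioo (0 : ℝ) 1)).prod (P.prod (μ.prod P))

instance isProbabilityMeasure_Ioo :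
    IsProbabilityMeasure (volume.restrict (Set.Ioo (0 : ℝ) 1)) := ⟨by simp⟩

/-- For fixed u both subtrees grow linearly in N, so their normalized walks converge almost surely
on the product space. Exponentials of modulus 1 allow dominated convergence. -/
lemma tendsto_integral_exp_splitWalk [IsProbabilityMeasure P] [IsProbabilityMeasure μ]
    (W : RWES P p ν μ) (hμ0 : ∀ᵐ x ∂μ, 0 ≤ x) (hμ : Integrable (fun x : ℝ => x) μ)
    (hm : 0 < echoMoment μ 1) (s : ℝ) {u : ℝ} (hu : u ∈ Set.Ioo (0 : ℝ) 1) :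
    Tendsto (fun N : ℕ => ∫ z, Complex.exp ((s / ((N : ℝ) + 2) ^ echoMoment μ 1 : ℝ) *
        W.splitWalk (⌊((N : ℝ) + 1) * u⌋₊ + 1) (N - ⌊((N : ℝ) + 1) * u⌋₊ + 1) z * Complex.I)
        ∂(P.prod (μ.prod P))) atTop
      (𝓝 (∫ z, Complex.exp (s * W.smoothing (u, z) * Complex.I) ∂(P.prod (μ.prod P)))) := by
  refine tendsto_integral_of_dominated_convergence (fun _ => 1) (fun N => ?_)
    (integrable_const _) (fun N => ae_of_all _ fun z => ?_) ?_
  · have := W.measurable_splitWalk (⌊((N : ℝ) + 1) * u⌋₊ + 1) (N - ⌊((N : ℝ) + 1) * u⌋₊ + 1)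
    exact Measurable.aestronglyMeasurable (by fun_prop)
  · rw [← Complex.ofReal_mul, Complex.norm_exp_ofReal_mul_I]
  · have hL := W.ae_tendsto_limitWalk hμ0 hμ hm
    have h1 : ∀ᵐ z ∂(P.prod (μ.prod P)), Tendsto (fun n : ℕ => W.pureWalk n z.1 /
        (n : ℝ) ^ echoMoment μ 1) atTop (𝓝 (W.limitWalk z.1)) :=
      Measure.quasiMeasurePreserving_fst.ae hL
    have h2 : ∀ᵐ z ∂(P.prod (μ.prod P)), Tendsto (fun n : ℕ => W.pureWalk n z.2.2 /
        (n : ℝ) ^ echoMoment μ 1) atTop (𝓝 (W.limitWalk z.2.2)) :=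
      Measure.quasiMeasurePreserving_snd.ae (Measure.quasiMeasurePreserving_snd.ae hL)
    filter_upwards [h1, h2] with z h1 h2
    have h3 := tendsto_div_rpow_of_tendsto_div hu.1 h1 (tendsto_floor_add_one_div hu.1.le)
    have h4 := tendsto_div_rpow_of_tendsto_div (sub_pos.2 hu.2) h2
      (tendsto_floor_sub_add_one_div hu)
    have h5 := (h3.add (h4.const_mul z.2.1)).const_mul s
    have hc : Continuous fun x : ℝ => Complex.exp (x * Complex.I) := by fun_prop
    refine ((hc.tendsto _).comp h5).congr' ?_ |>.trans ?_
    · refine Eventually.of_forall fun N => ?_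
      simp only [Function.comp_apply, splitWalk]
      congr 2
      push_cast
      ring
    · simp [smoothing]

/-- The limit satisfies the smoothing equation in law. -/
theorem map_limitWalk_eq_map_smoothing [IsProbabilityMeasure P] [IsProbabilityMeasure μ]
    (W : RWES P p ν μ) (hμ0 : ∀ᵐ x ∂μ, 0 ≤ x) (hμ : Integrable (fun x : ℝ => x) μ)
    (hm : 0 < echoMoment μ 1) :
    P.map W.limitWalk = (smoothingLaw P μ).map W.smoothing := by
  have := Measure.isProbabilityMeasure_map (μ := P) W.measurable_limitWalk.aemeasurable
  have := Measure.isProbabilityMeasure_map (μ := smoothingLaw P μ)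
    W.measurable_smoothing.aemeasurable
  refine Measure.ext_of_charFun (funext fun s => ?_)
  have hexp : Measurable fun x : ℝ => Complex.exp (s * x * Complex.I) := by fun_prop
  rw [charFun_apply_real, charFun_apply_real,
    integral_map W.measurable_limitWalk.aemeasurable hexp.aestronglyMeasurable,
    integral_map W.measurable_smoothing.aemeasurable hexp.aestronglyMeasurable,
    integral_prod]
  swap
  · refine Integrable.of_bound
      (hexp.comp W.measurable_smoothing).aestronglyMeasurable 1 (ae_of_all _ fun x => ?_)
    rw [← Complex.ofReal_mul, Complex.norm_exp_ofReal_mul_I]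
  have hl : Tendsto (fun N : ℕ => ∫ ω, Complex.exp ((s / ((N : ℝ) + 2) ^ echoMoment μ 1 : ℝ) *
      W.pureWalk (N + 2) ω * Complex.I) ∂P) atTop
      (𝓝 (∫ ω, Complex.exp (s * W.limitWalk ω * Complex.I) ∂P)) := by
    refine tendsto_integral_of_dominated_convergence (fun _ => 1) (fun N => ?_)
      (integrable_const _) (fun N => ae_of_all _ fun z => ?_) ?_
    · have := W.measurable_pureWalk (N + 2)
      exact Measurable.aestronglyMeasurable (by fun_prop)
    · rw [← Complex.ofReal_mul, Complex.norm_exp_ofReal_mul_I]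
    · filter_upwards [W.ae_tendsto_limitWalk hμ0 hμ hm] with ω h
      have h1 := ((tendsto_add_atTop_iff_nat 2).2 h).const_mul s
      have hc : Continuous fun x : ℝ => Complex.exp (x * Complex.I) := by fun_prop
      refine ((hc.tendsto _).comp h1).congr' ?_ |>.trans ?_
      · refine Eventually.of_forall fun N => ?_
        simp only [Function.comp_apply]
        congr 2
        push_cast
        ring
      · simp
  refine tendsto_nhds_unique hl ?_
  -- The average over the split index becomes an integral over u in (0,1), so that dominated
  -- convergence applies once more.
  have heq : ∀ N : ℕ, ∫ ω, Complex.exp ((s / ((N : ℝ) + 2) ^ echoMoment μ 1 : ℝ) *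
      W.pureWalk (N + 2) ω * Complex.I) ∂P = ∫ u in Set.Ioo (0 : ℝ) 1,
        ∫ z, Complex.exp ((s / ((N : ℝ) + 2) ^ echoMoment μ 1 : ℝ) *
        W.splitWalk (⌊((N : ℝ) + 1) * u⌋₊ + 1) (N - ⌊((N : ℝ) + 1) * u⌋₊ + 1) z * Complex.I)
        ∂(P.prod (μ.prod P)) := by
    intro N
    have h1 := W.integral_exp_pureWalk_split N (s / ((N : ℝ) + 2) ^ echoMoment μ 1)
    rw [Finset.Nat.sum_antidiagonal_eq_sum_range_succ_mk] at h1
    rw [← average_range_eq_integral N fun k =>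
      ∫ z, Complex.exp ((s / ((N : ℝ) + 2) ^ echoMoment μ 1 : ℝ) *
        W.splitWalk (k + 1) (N - k + 1) z * Complex.I) ∂(P.prod (μ.prod P)), ← h1]
    have hN : ((N : ℂ) + 1) ≠ 0 := by exact_mod_cast N.succ_ne_zero
    rw [inv_mul_cancel_left₀ hN]
  simp only [heq]
  refine tendsto_integral_of_dominated_convergence (fun _ => 1) (fun N => ?_)
    (integrable_const _) (fun N => ae_of_all _ fun u => ?_) ?_
  · exact ((measurable_from_nat (f := fun k =>
      ∫ z, Complex.exp ((s / ((N : ℝ) + 2) ^ echoMoment μ 1 : ℝ) *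
        W.splitWalk (k + 1) (N - k + 1) z * Complex.I) ∂(P.prod (μ.prod P)))).comp
      (Nat.measurable_floor.comp (measurable_const_mul _))).aestronglyMeasurable
  · have : ∀ z, ‖Complex.exp ((s / ((N : ℝ) + 2) ^ echoMoment μ 1 : ℝ) *
        W.splitWalk (⌊((N : ℝ) + 1) * u⌋₊ + 1) (N - ⌊((N : ℝ) + 1) * u⌋₊ + 1) z *
          Complex.I)‖ ≤ 1 := fun z => by
      rw [← Complex.ofReal_mul, Complex.norm_exp_ofReal_mul_I]
    simpa using norm_integral_le_of_norm_le_const (ae_of_all (P.prod (μ.prod P)) this)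
  · filter_upwards [ae_restrict_mem measurableSet_Ioo] with u hu
    exact W.tendsto_integral_exp_splitWalk hμ0 hμ hm s hu

end RWES

/-! ### Inequalities for the moment recursion. -/

/-- Bernoulli's inequality for 1 - b/(a+b) bounds the increase by γ (a+b)^(γ-1) b; then a + b ≤ 2a
accounts for the factor 2^(γ-1). -/
lemma add_rpow_le_of_le {a b γ : ℝ} (hb : 0 ≤ b) (hba : b ≤ a) (hγ : 1 ≤ γ) :
    (a + b) ^ γ ≤ a ^ γ + γ * 2 ^ (γ - 1) * (a ^ (γ - 1) * b) := by
  rcases hb.eq_or_lt with rfl | hb0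
  · simp
  have ha : 0 < a := hb0.trans_le hba
  have hab : 0 < a + b := by linarith
  have h1 := one_add_mul_self_le_rpow_one_add (s := -(b / (a + b))) (p := γ)
    (by rw [neg_le_neg_iff, div_le_one hab]; linarith) hγ
  have h2 : 1 + -(b / (a + b)) = a / (a + b) := by field_simp; ring
  rw [h2, Real.div_rpow ha.le hab.le, le_div_iff₀ (by positivity)] at h1
  have h3 : (a + b) ^ γ = (a + b) ^ (γ - 1) * (a + b) := by
    rw [Real.rpow_sub_one hab.ne', div_mul_cancel₀ _ hab.ne']
  have h4 : (a + b) ^ (γ - 1) ≤ 2 ^ (γ - 1) * a ^ (γ - 1) := by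
    rw [← Real.mul_rpow (by norm_num) ha.le]
    exact Real.rpow_le_rpow hab.le (by linarith) (by linarith)
  have h5 : (1 + γ * -(b / (a + b))) * (a + b) ^ γ =
      (a + b) ^ γ - γ * ((a + b) ^ (γ - 1) * b) := by
    rw [h3]; field_simp; ring
  rw [h5] at h1
  have h6 : γ * ((a + b) ^ (γ - 1) * b) ≤ γ * ((2 ^ (γ - 1) * a ^ (γ - 1)) * b) := by gcongr
  linarith

/-- The point is the coefficient 1 in front of a^γ and b^γ: it preserves the factor 1 + m_γ in the
recursion, which a convexity bound would inflate. -/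
lemma add_rpow_le_add_cross {a b γ : ℝ} (ha : 0 ≤ a) (hb : 0 ≤ b) (hγ : 1 ≤ γ) :
    (a + b) ^ γ ≤ a ^ γ + b ^ γ +
      γ * 2 ^ (γ - 1) * (a ^ (γ - 1) * b + a * b ^ (γ - 1)) := by
  have h1 : 0 ≤ γ * 2 ^ (γ - 1) * (a ^ (γ - 1) * b) := by positivity
  have h2 : 0 ≤ γ * 2 ^ (γ - 1) * (a * b ^ (γ - 1)) := by positivity
  have h3 : 0 ≤ a ^ γ := by positivity
  have h4 : 0 ≤ b ^ γ := by positivity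
  rw [mul_add]
  rcases le_total b a with h | h
  · linarith [add_rpow_le_of_le hb h hγ]
  · have := add_rpow_le_of_le ha h hγ
    rw [add_comm b a, mul_comm _ a] at this
    linarith

lemma ENNReal.add_rpow_le_add_cross (a b : ℝ≥0∞) {γ : ℝ} (hγ : 1 ≤ γ) :
    (a + b) ^ γ ≤ a ^ γ + b ^ γ +
      ENNReal.ofReal (γ * 2 ^ (γ - 1)) * (a ^ (γ - 1) * b + a * b ^ (γ - 1)) := by
  have hγ0 : 0 < γ := by linarith
  rcases eq_or_ne a ∞ with rfl | ha
  · simp [ENNReal.top_rpow_of_pos hγ0]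
  rcases eq_or_ne b ∞ with rfl | hb
  · simp [ENNReal.top_rpow_of_pos hγ0]
  have h := ENNReal.ofReal_le_ofReal
    (_root_.add_rpow_le_add_cross (a := a.toReal) (b := b.toReal) (by simp) (by simp) hγ)
  have hγ1 : 0 ≤ γ - 1 := by linarith
  have hC : 0 ≤ γ * 2 ^ (γ - 1) := by positivity
  generalize γ * 2 ^ (γ - 1) = C at h hC ⊢
  rw [ENNReal.ofReal_add (by positivity) (by positivity),
    ENNReal.ofReal_add (by positivity) (by positivity), ENNReal.ofReal_mul hC,
    ENNReal.ofReal_add (by positivity) (by positivity),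
    ENNReal.ofReal_mul (p := a.toReal ^ (γ - 1)) (by positivity),
    ENNReal.ofReal_mul (p := a.toReal) (by positivity)] at h
  simp only [← ENNReal.ofReal_rpow_of_nonneg ENNReal.toReal_nonneg hγ0.le,
    ← ENNReal.ofReal_rpow_of_nonneg ENNReal.toReal_nonneg hγ1, ENNReal.ofReal_toReal ha,
    ENNReal.ofReal_toReal hb] at h
  rwa [← ENNReal.ofReal_rpow_of_nonneg (by positivity) hγ0.le,
    ENNReal.ofReal_add (by positivity) (by positivity), ENNReal.ofReal_toReal ha,
    ENNReal.ofReal_toReal hb] at h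

/-- Comparison with the integral of x^p, obtained from Bernoulli in the form x^(p+1) + (p+1) x^p ≤
(x+1)^(p+1). -/
lemma sum_range_add_one_rpow_le {p : ℝ} (hp : 0 ≤ p) (n : ℕ) :
    ∑ k ∈ Finset.range n, ((k : ℝ) + 1) ^ p ≤ ((n : ℝ) + 1) ^ (p + 1) / (p + 1) := by
  induction n with
  | zero => simp; positivity
  | succ n ih =>
    rw [Finset.sum_range_succ]
    have hx : (0 : ℝ) < (n : ℝ) + 1 := by positivity
    set x : ℝ := (n : ℝ) + 1 with hxdef
    have h1 := one_add_mul_self_le_rpow_one_add (s := 1 / x) (p := p + 1)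
      (by have : 0 < 1 / x := by positivity
          linarith) (by linarith)
    have h2 : 1 + 1 / x = (x + 1) / x := by field_simp
    rw [h2, Real.div_rpow (by positivity) hx.le, le_div_iff₀ (by positivity)] at h1
    have h3 : x ^ (p + 1) = x ^ p * x := Real.rpow_add_one hx.ne' p
    have h4 : (1 + (p + 1) * (1 / x)) * x ^ (p + 1) = x ^ (p + 1) + (p + 1) * x ^ p := by
      rw [h3]; field_simp
    rw [h4] at h1
    push_cast
    rw [← hxdef]
    calc _ ≤ x ^ (p + 1) / (p + 1) + x ^ p := by linarith
      _ = (x ^ (p + 1) + (p + 1) * x ^ p) / (p + 1) := by field_simp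
      _ ≤ _ := by gcongr

/-- Growth of a sequence dominated by the average of its previous values. -/
lemma exists_le_mul_rpow_of_average_le {e : ℕ → ℝ} (he : ∀ n, 0 ≤ e n) {c p B : ℝ} (hc : 0 ≤ c)
    (hcp : c < p) (hB : 0 ≤ B)
    (h : ∀ N : ℕ, ((N : ℝ) + 1) * e (N + 1) ≤
      (1 + c) * ∑ k ∈ Finset.range (N + 1), e k + B * (((N : ℝ) + 1) * ((N : ℝ) + 2) ^ p)) :
    ∃ D : ℝ, ∀ n : ℕ, e n ≤ D * ((n : ℝ) + 1) ^ p := by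
  -- Averaging (k+1)^p produces the factor 1/(p+1), so r₀ is the asymptotic contraction rate; it is
  -- below 1 exactly because c < p. The midpoint r leaves room for the ratio (N+2)/(N+1).
  set r₀ : ℝ := (1 + c) / (p + 1) with hr₀
  have hp : 0 < p := by linarith
  have hr₀1 : r₀ < 1 := by rw [hr₀, div_lt_one (by linarith)]; linarith
  have hr₀0 : 0 ≤ r₀ := by positivity
  set r : ℝ := (1 + r₀) / 2 with hr
  have hlim : Tendsto (fun N : ℕ => r₀ * (((N : ℝ) + 2) / (N + 1))) atTop (𝓝 r₀) := by
    have h1 : Tendsto (fun N : ℕ => 1 + ((N : ℝ) + 1)⁻¹) atTop (𝓝 (1 + 0)) :=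
      tendsto_const_nhds.add (tendsto_inv_atTop_zero.comp
        (tendsto_atTop_add_const_right _ _ tendsto_natCast_atTop_atTop))
    have h2 := h1.const_mul r₀
    rw [add_zero, mul_one] at h2
    refine h2.congr fun N => ?_
    have : (N : ℝ) + 1 ≠ 0 := by positivity
    field_simp
    ring
  obtain ⟨n₀, hn₀⟩ := eventually_atTop.1 (hlim.eventually_le_const (show r₀ < r by linarith))
  -- The sum covers the indices up to n₀, and the term B/(1-r) ensures Dr + B ≤ D for the later
  -- ones.
  set D : ℝ := ∑ k ∈ Finset.range (n₀ + 1), e k + B / (1 - r) with hD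
  have hr1 : 0 < 1 - r := by linarith
  have hsum : 0 ≤ ∑ k ∈ Finset.range (n₀ + 1), e k := Finset.sum_nonneg fun k _ => he k
  have hBr : 0 ≤ B / (1 - r) := by positivity
  have hD0 : 0 ≤ D := by positivity
  refine ⟨D, fun n => ?_⟩
  induction n using Nat.strong_induction_on with
  | _ n ih =>
    rcases Nat.lt_or_ge n (n₀ + 1) with hn | hn
    · have h1 : e n ≤ D := by
        have := Finset.single_le_sum (fun k _ => he k) (Finset.mem_range.2 hn)
        linarith
      have h2 : (1 : ℝ) ≤ ((n : ℝ) + 1) ^ p :=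
        Real.one_le_rpow (by linarith [n.cast_nonneg (α := ℝ)]) hp.le
      nlinarith
    · obtain ⟨N, rfl⟩ : ∃ N, n = N + 1 := ⟨n - 1, by omega⟩
      have h1 : ∑ k ∈ Finset.range (N + 1), e k ≤
          D * (((N : ℝ) + 2) ^ (p + 1) / (p + 1)) := by
        calc ∑ k ∈ Finset.range (N + 1), e k
            ≤ ∑ k ∈ Finset.range (N + 1), D * ((k : ℝ) + 1) ^ p :=
              Finset.sum_le_sum fun k hk => ih k (Finset.mem_range.1 hk)
          _ = D * ∑ k ∈ Finset.range (N + 1), ((k : ℝ) + 1) ^ p := by rw [Finset.mul_sum]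
          _ ≤ _ := by
              have := sum_range_add_one_rpow_le hp.le (N + 1)
              push_cast at this
              rw [add_assoc (N : ℝ) 1 1, one_add_one_eq_two] at this
              gcongr
      have h2 := h N
      have hN1 : (0 : ℝ) < (N : ℝ) + 1 := by positivity
      have hX : (0 : ℝ) < ((N : ℝ) + 2) ^ p := by positivity
      have h3 := hn₀ N (by omega)
      have h4 : ((N : ℝ) + 2) ^ (p + 1) = ((N : ℝ) + 2) ^ p * ((N : ℝ) + 2) :=
        Real.rpow_add_one (by positivity) p
      have h5 : ((N : ℝ) + 1) * e (N + 1) ≤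
          ((N : ℝ) + 1) * ((D * (r₀ * (((N : ℝ) + 2) / (N + 1))) + B) * ((N : ℝ) + 2) ^ p) := by
        refine h2.trans ?_
        have h6 := mul_le_mul_of_nonneg_left h1 (show 0 ≤ 1 + c by linarith)
        refine (add_le_add_left h6 _).trans (le_of_eq ?_)
        rw [h4, hr₀]
        field_simp
      have h7 := le_of_mul_le_mul_left h5 hN1
      push_cast
      rw [add_assoc (N : ℝ) 1 1, one_add_one_eq_two]
      refine h7.trans ?_
      gcongr
      have h8 : D * (r₀ * (((N : ℝ) + 2) / (N + 1))) ≤ D * r :=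
        mul_le_mul_of_nonneg_left h3 hD0
      have h9 : B = (1 - r) * (B / (1 - r)) := by field_simp
      have h10 : (1 - r) * (B / (1 - r)) ≤ (1 - r) * D :=
        mul_le_mul_of_nonneg_left (by linarith) hr1.le
      linarith

lemma lintegral_ofReal_rpow_eq {μ : Measure ℝ} (hμ0 : ∀ᵐ x ∂μ, 0 ≤ x) {γ : ℝ} (hγ : 0 ≤ γ)
    (hint : Integrable (fun x : ℝ => x ^ γ) μ) :
    ∫⁻ x, ENNReal.ofReal x ^ γ ∂μ = ENNReal.ofReal (echoMoment μ γ) := by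
  rw [echoMoment, ofReal_integral_eq_lintegral_ofReal hint
    (hμ0.mono fun x hx => Real.rpow_nonneg hx γ)]
  refine lintegral_congr_ae ?_
  filter_upwards [hμ0] with x hx
  exact ENNReal.ofReal_rpow_of_nonneg hx hγ

/-- Log-convexity of x^δ in the exponent: δ is the convex combination of 1 and γ with these weights.
-/
lemma rpow_le_weighted {x γ δ : ℝ} (hx : 0 ≤ x) (h1 : 1 ≤ δ) (hδγ : δ ≤ γ) (hγ : 1 < γ) :
    x ^ δ ≤ (γ - δ) / (γ - 1) * x + (δ - 1) / (γ - 1) * x ^ γ := by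
  have hγ1 : 0 < γ - 1 := by linarith
  have h := Real.geom_mean_le_arith_mean2_weighted (w₁ := (γ - δ) / (γ - 1))
    (w₂ := (δ - 1) / (γ - 1)) (p₁ := x) (p₂ := x ^ γ) (div_nonneg (by linarith) hγ1.le)
    (div_nonneg (by linarith) hγ1.le) hx (by positivity) (by field_simp; ring)
  rw [← Real.rpow_mul hx] at h
  rcases hx.eq_or_lt with rfl | hx0
  · rw [Real.zero_rpow (by linarith), Real.zero_rpow (by linarith)]
    simp
  · rw [← Real.rpow_add hx0] at h
    have : (γ - δ) / (γ - 1) + γ * ((δ - 1) / (γ - 1)) = δ := by field_simp; ring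
    rwa [this] at h

lemma integrable_rpow_of_le {μ : Measure ℝ} (hμ0 : ∀ᵐ x ∂μ, 0 ≤ x)
    (hμ : Integrable (fun x : ℝ => x) μ) {γ δ : ℝ} (h1 : 1 ≤ δ) (hδγ : δ ≤ γ) (hγ : 1 < γ)
    (hint : Integrable (fun x : ℝ => x ^ γ) μ) : Integrable (fun x : ℝ => x ^ δ) μ := by
  refine ((hμ.const_mul ((γ - δ) / (γ - 1))).add (hint.const_mul ((δ - 1) / (γ - 1)))).mono'
    (by fun_prop) ?_
  filter_upwards [hμ0] with x hx
  rw [Real.norm_of_nonneg (Real.rpow_nonneg hx _)]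
  exact rpow_le_weighted hx h1 hδγ hγ

lemma integrable_rpow_of_le_one {μ : Measure ℝ} [IsFiniteMeasure μ] (hμ0 : ∀ᵐ x ∂μ, 0 ≤ x)
    (hμ : Integrable (fun x : ℝ => x) μ) {δ : ℝ} (h0 : 0 ≤ δ) (h1 : δ ≤ 1) :
    Integrable (fun x : ℝ => x ^ δ) μ := by
  refine ((integrable_const (1 : ℝ)).add hμ).mono' (by fun_prop) ?_
  filter_upwards [hμ0] with x hx
  rw [Real.norm_of_nonneg (Real.rpow_nonneg hx _)]
  rcases le_total x 1 with h | h
  · exact (Real.rpow_le_one hx h h0).trans (by simpa using hx)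
  · exact (Real.rpow_le_rpow_of_exponent_le h h1).trans (by simp)

/-- `Λ` is downward closed in `(1, ∞)`. -/
lemma echoExponents_of_le {μ : Measure ℝ} (hμ0 : ∀ᵐ x ∂μ, 0 ≤ x)
    (hμ : Integrable (fun x : ℝ => x) μ) {γ δ : ℝ} (hγ : 1 < γ)
    (hint : Integrable (fun x : ℝ => x ^ γ) μ) (hlt : echoMoment μ γ < γ * echoMoment μ 1)
    (h1 : 1 < δ) (hδγ : δ ≤ γ) :
    Integrable (fun x : ℝ => x ^ δ) μ ∧ echoMoment μ δ < δ * echoMoment μ 1 := by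
  have hi := integrable_rpow_of_le hμ0 hμ h1.le hδγ hγ hint
  refine ⟨hi, ?_⟩
  have hγ1 : 0 < γ - 1 := by linarith
  have hle : echoMoment μ δ ≤
      (γ - δ) / (γ - 1) * echoMoment μ 1 + (δ - 1) / (γ - 1) * echoMoment μ γ := by
    have h2 : (γ - δ) / (γ - 1) * echoMoment μ 1 + (δ - 1) / (γ - 1) * echoMoment μ γ =
        ∫ x, ((γ - δ) / (γ - 1) * x + (δ - 1) / (γ - 1) * x ^ γ) ∂μ := by
      rw [integral_add (hμ.const_mul _) (hint.const_mul _), integral_const_mul,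
        integral_const_mul, RWES.echoMoment_one, echoMoment]
    rw [h2]
    refine integral_mono_ae hi ((hμ.const_mul _).add (hint.const_mul _)) ?_
    filter_upwards [hμ0] with x hx
    exact rpow_le_weighted hx h1.le hδγ hγ
  have hw : 0 < (δ - 1) / (γ - 1) := div_pos (by linarith) hγ1
  calc echoMoment μ δ ≤ _ := hle
    _ < (γ - δ) / (γ - 1) * echoMoment μ 1 + (δ - 1) / (γ - 1) * (γ * echoMoment μ 1) := by gcongr
    _ = δ * echoMoment μ 1 := by field_simp; ring

/-! ### Growth of the moments of the walk. -/

namespace RWES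

variable {Ω : Type*} [mΩ : MeasurableSpace Ω] {P : Measure Ω} {p : ℝ} {ν μ : Measure ℝ}

/-- The moment of order `γ` of the walk after `n` steps. -/
noncomputable def walkMoment (W : RWES P p ν μ) (γ : ℝ) (n : ℕ) : ℝ≥0∞ :=
  ∫⁻ ω, ENNReal.ofReal (W.pureWalk n ω) ^ γ ∂P

lemma measurable_ofReal_pureWalk_rpow (W : RWES P p ν μ) (γ : ℝ) (n : ℕ) :
    Measurable fun ω => ENNReal.ofReal (W.pureWalk n ω) ^ γ :=
  (W.measurable_pureWalk n).ennreal_ofReal.pow_const γ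

lemma walkMoment_one_eq [IsProbabilityMeasure P] (W : RWES P p ν μ) (γ : ℝ) :
    W.walkMoment γ 1 = 1 := by
  simp [walkMoment]

lemma walkMoment_one [IsProbabilityMeasure P] (W : RWES P p ν μ) (hμ0 : ∀ᵐ x ∂μ, 0 ≤ x)
    (hμ : Integrable (fun x : ℝ => x) μ) (n : ℕ) :
    W.walkMoment 1 (n + 1) = ENNReal.ofReal (meanWalk (echoMoment μ 1) n) := by
  have h := W.integral_normWalk hμ0 hμ n
  simp only [normWalk] at h
  rw [integral_div, div_eq_one_iff_eq (meanWalk_pos (echoMoment_nonneg hμ0 1) n).ne'] at h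
  rw [← h, ofReal_integral_eq_lintegral_ofReal (W.integrable_pureWalk hμ _)
    ((W.ae_pureWalk_nonneg hμ0).mono fun ω hω => hω _)]
  simp [walkMoment]

lemma lintegral_prod₃ [IsProbabilityMeasure P] [IsProbabilityMeasure μ]
    {f g : Ω → ℝ≥0∞} {h : ℝ → ℝ≥0∞} (hf : Measurable f) (hg : Measurable g) (hh : Measurable h) :
    ∫⁻ z, f z.1 * (h z.2.1 * g z.2.2) ∂(P.prod (μ.prod P)) =
      (∫⁻ ω, f ω ∂P) * ((∫⁻ x, h x ∂μ) * ∫⁻ ω, g ω ∂P) := by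
  rw [lintegral_prod_mul (g := fun w : ℝ × Ω => h w.1 * g w.2) hf.aemeasurable
    (by fun_prop), lintegral_prod_mul hh.aemeasurable hg.aemeasurable]

/-- Independence factorizes every term of the cross-term inequality. The cross terms involve only
the orders 1 and γ - 1. -/
lemma lintegral_splitWalk_rpow_le [IsProbabilityMeasure P] [IsProbabilityMeasure μ]
    (W : RWES P p ν μ) (hμ0 : ∀ᵐ x ∂μ, 0 ≤ x) {γ : ℝ} (hγ : 1 < γ) (i j : ℕ) :
    ∫⁻ z, ENNReal.ofReal (W.splitWalk i j z) ^ γ ∂(P.prod (μ.prod P)) ≤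
      W.walkMoment γ i + (∫⁻ x, ENNReal.ofReal x ^ γ ∂μ) * W.walkMoment γ j +
      ENNReal.ofReal (γ * 2 ^ (γ - 1)) *
        (W.walkMoment (γ - 1) i * ((∫⁻ x, ENNReal.ofReal x ^ (1 : ℝ) ∂μ) * W.walkMoment 1 j) +
        W.walkMoment 1 i *
          ((∫⁻ x, ENNReal.ofReal x ^ (γ - 1) ∂μ) * W.walkMoment (γ - 1) j)) := by
  have hpow : ∀ δ : ℝ, Measurable fun x : ℝ => ENNReal.ofReal x ^ δ := fun δ =>
    measurable_id.ennreal_ofReal.pow_const δ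
  have hm := W.measurable_ofReal_pureWalk_rpow
  have h2 : ∀ᵐ z ∂(P.prod (μ.prod P)), 0 ≤ z.2.1 :=
    Measure.quasiMeasurePreserving_snd.ae (Measure.quasiMeasurePreserving_fst.ae hμ0)
  have hfst : ∀ {f : Ω → ℝ≥0∞}, Measurable f →
      ∫⁻ z, f z.1 ∂(P.prod (μ.prod P)) = ∫⁻ ω, f ω ∂P := fun {f} hf => by
    simpa using lintegral_prod₃ (P := P) (μ := μ) (f := f) (g := fun _ => 1) (h := fun _ => 1) hf
      measurable_const measurable_const
  have hsnd : ∀ {g : Ω → ℝ≥0∞} {h : ℝ → ℝ≥0∞}, Measurable g → Measurable h →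
      ∫⁻ z, h z.2.1 * g z.2.2 ∂(P.prod (μ.prod P)) = (∫⁻ x, h x ∂μ) * ∫⁻ ω, g ω ∂P :=
    fun {g h} hg hh => by
      simpa using lintegral_prod₃ (P := P) (μ := μ) (f := fun _ => 1) (g := g) (h := h)
        measurable_const hg hh
  calc ∫⁻ z, ENNReal.ofReal (W.splitWalk i j z) ^ γ ∂(P.prod (μ.prod P))
      ≤ ∫⁻ z, (ENNReal.ofReal (W.pureWalk i z.1) ^ γ +
          ENNReal.ofReal z.2.1 ^ γ * ENNReal.ofReal (W.pureWalk j z.2.2) ^ γ +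
          ENNReal.ofReal (γ * 2 ^ (γ - 1)) *
          (ENNReal.ofReal (W.pureWalk i z.1) ^ (γ - 1) *
            (ENNReal.ofReal z.2.1 ^ (1 : ℝ) * ENNReal.ofReal (W.pureWalk j z.2.2) ^ (1 : ℝ)) +
          ENNReal.ofReal (W.pureWalk i z.1) ^ (1 : ℝ) * (ENNReal.ofReal z.2.1 ^ (γ - 1) *
            ENNReal.ofReal (W.pureWalk j z.2.2) ^ (γ - 1))))
          ∂(P.prod (μ.prod P)) := by
        refine lintegral_mono_ae ?_
        filter_upwards [h2] with z h2
        have h3 : ENNReal.ofReal (W.splitWalk i j z) ≤ ENNReal.ofReal (W.pureWalk i z.1) +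
            ENNReal.ofReal z.2.1 * ENNReal.ofReal (W.pureWalk j z.2.2) := by
          rw [← ENNReal.ofReal_mul h2]
          exact ENNReal.ofReal_add_le
        refine (ENNReal.rpow_le_rpow h3 (by linarith)).trans
          ((ENNReal.add_rpow_le_add_cross _ _ hγ.le).trans (le_of_eq ?_))
        rw [ENNReal.mul_rpow_of_nonneg _ _ (by linarith : 0 ≤ γ),
          ENNReal.mul_rpow_of_nonneg _ _ (by linarith : 0 ≤ γ - 1)]
        simp only [ENNReal.rpow_one]
    _ = _ := by
        have hm1 : ∀ (δ : ℝ) (i : ℕ), Measurable fun z : Ω × ℝ × Ω =>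
            ENNReal.ofReal (W.pureWalk i z.1) ^ δ := fun δ i => (hm δ i).comp measurable_fst
        have hm2 : ∀ (δ : ℝ) (i : ℕ), Measurable fun z : Ω × ℝ × Ω =>
            ENNReal.ofReal (W.pureWalk i z.2.2) ^ δ := fun δ i =>
          (hm δ i).comp measurable_snd.snd
        have hm3 : ∀ δ : ℝ, Measurable fun z : Ω × ℝ × Ω => ENNReal.ofReal z.2.1 ^ δ := fun δ =>
          (hpow δ).comp measurable_snd.fst
        have hm4 : Measurable fun z : Ω × ℝ × Ω => ENNReal.ofReal (W.pureWalk i z.1) ^ γ +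
            ENNReal.ofReal z.2.1 ^ γ * ENNReal.ofReal (W.pureWalk j z.2.2) ^ γ :=
          (hm1 _ _).add ((hm3 _).mul (hm2 _ _))
        have hm5 : Measurable fun z : Ω × ℝ × Ω => ENNReal.ofReal (W.pureWalk i z.1) ^ (γ - 1) *
            (ENNReal.ofReal z.2.1 ^ (1 : ℝ) * ENNReal.ofReal (W.pureWalk j z.2.2) ^ (1 : ℝ)) :=
          (hm1 _ _).mul ((hm3 _).mul (hm2 _ _))
        rw [lintegral_add_left hm4,
          lintegral_add_left (hm1 _ _), lintegral_const_mul' _ _ ENNReal.ofReal_ne_top,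
          lintegral_add_left hm5, hfst (hm _ _),
          hsnd (hm _ _) (hpow _), lintegral_prod₃ (hm _ _) (hm _ _) (hpow _),
          lintegral_prod₃ (hm _ _) (hm _ _) (hpow _)]
        rfl

/-- The moment of order `γ` of the walk after `n` steps is of order at most `n ^ (γ m_1)`. -/
def HasMomentGrowth (W : RWES P p ν μ) (γ : ℝ) : Prop :=
  ∃ D : ℝ, 0 ≤ D ∧ ∀ n : ℕ,
    W.walkMoment γ (n + 1) ≤ ENNReal.ofReal (D * ((n : ℝ) + 1) ^ (γ * echoMoment μ 1))

lemma hasMomentGrowth_one [IsProbabilityMeasure P] (W : RWES P p ν μ)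
    (hμ0 : ∀ᵐ x ∂μ, 0 ≤ x) (hμ : Integrable (fun x : ℝ => x) μ) (hm : 0 < echoMoment μ 1) :
    W.HasMomentGrowth 1 := by
  obtain ⟨D, hD⟩ := (tendsto_meanWalk_div_rpow hm).bddAbove_range
  have hD' : ∀ n : ℕ, meanWalk (echoMoment μ 1) n ≤ D * ((n : ℝ) + 1) ^ echoMoment μ 1 := by
    intro n
    have h := hD (Set.mem_range_self n)
    push_cast at h
    rwa [div_le_iff₀ (by positivity)] at h
  refine ⟨D, ?_, fun n => ?_⟩
  · have h := (meanWalk_pos hm.le 0).le.trans (hD' 0)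
    simpa using h
  · rw [W.walkMoment_one hμ0 hμ, one_mul]
    exact ENNReal.ofReal_le_ofReal (hD' n)

/-- Base case of the induction on the exponent: Jensen's inequality compares with the first moment.
-/
lemma hasMomentGrowth_of_le_one [IsProbabilityMeasure P] (W : RWES P p ν μ)
    (hμ0 : ∀ᵐ x ∂μ, 0 ≤ x) (hμ : Integrable (fun x : ℝ => x) μ) (hm : 0 < echoMoment μ 1)
    {γ : ℝ} (h0 : 0 < γ) (h1 : γ ≤ 1) : W.HasMomentGrowth γ := by
  obtain ⟨D, hD0, hD⟩ := W.hasMomentGrowth_one hμ0 hμ hm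
  refine ⟨D ^ γ, by positivity, fun n => ?_⟩
  have hJ : W.walkMoment γ (n + 1) ≤ W.walkMoment 1 (n + 1) ^ γ := by
    have h := eLpNorm_le_eLpNorm_of_exponent_le (p := ENNReal.ofReal γ) (q := 1) (μ := P)
      (f := fun ω => ENNReal.ofReal (W.pureWalk (n + 1) ω))
      (by simpa using ENNReal.ofReal_le_ofReal h1)
      (W.measurable_pureWalk _).ennreal_ofReal.aestronglyMeasurable
    rw [eLpNorm_eq_lintegral_rpow_enorm_toReal (by simpa using h0) ENNReal.ofReal_ne_top,
      ENNReal.toReal_ofReal h0.le, eLpNorm_one_eq_lintegral_enorm, one_div] at h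
    have h2 := (ENNReal.rpow_inv_le_iff h0).1 h
    simpa [walkMoment] using h2
  refine hJ.trans ((ENNReal.rpow_le_rpow (hD n) h0.le).trans (le_of_eq ?_))
  rw [ENNReal.ofReal_rpow_of_nonneg (by positivity) h0.le, Real.mul_rpow hD0 (by positivity),
    ← Real.rpow_mul (by positivity)]
  congr 3
  ring

end RWES

namespace RWES

variable {Ω : Type*} [mΩ : MeasurableSpace Ω] {P : Measure Ω} {p : ℝ} {ν μ : Measure ℝ}

/-- The cross terms have order N^((γ-1)m) · N^m = N^(γm), the very order to be proved for the γ-th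
moment, so they act as an additive error. -/
lemma walkMoment_recursion [IsProbabilityMeasure P] [IsProbabilityMeasure μ] (W : RWES P p ν μ)
    (hμ0 : ∀ᵐ x ∂μ, 0 ≤ x) (hμ : Integrable (fun x : ℝ => x) μ) (hm : 0 < echoMoment μ 1)
    {γ : ℝ} (hγ : 1 < γ) (hint : Integrable (fun x : ℝ => x ^ γ) μ)
    (hint' : Integrable (fun x : ℝ => x ^ (γ - 1)) μ) (hG : W.HasMomentGrowth (γ - 1)) :
    ∃ B : ℝ, 0 ≤ B ∧ ∀ N : ℕ, ((N : ℝ≥0∞) + 1) * W.walkMoment γ (N + 2) ≤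
      ∑ ij ∈ Finset.HasAntidiagonal.antidiagonal N, (W.walkMoment γ (ij.1 + 1) +
        ENNReal.ofReal (echoMoment μ γ) * W.walkMoment γ (ij.2 + 1) +
        ENNReal.ofReal (B * ((N : ℝ) + 2) ^ (γ * echoMoment μ 1))) := by
  obtain ⟨D₁, hD₁0, hD₁⟩ := W.hasMomentGrowth_one hμ0 hμ hm
  obtain ⟨D, hD0, hD⟩ := hG
  set m := echoMoment μ 1 with hmdef
  set b := echoMoment μ (γ - 1) with hbdef
  have hb : 0 ≤ b := echoMoment_nonneg hμ0 _
  have hC : 0 ≤ γ * 2 ^ (γ - 1) := by positivity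
  refine ⟨γ * 2 ^ (γ - 1) * (D * (m * D₁) + D₁ * (b * D)), by positivity, fun N => ?_⟩
  rw [walkMoment, W.lintegral_pureWalk_split N (f := fun x => ENNReal.ofReal x ^ γ)
    (measurable_id.ennreal_ofReal.pow_const γ)]
  refine Finset.sum_le_sum fun ij hij => ?_
  have hN : ij.1 + ij.2 = N := Finset.HasAntidiagonal.mem_antidiagonal.1 hij
  refine (W.lintegral_splitWalk_rpow_le hμ0 hγ _ _).trans ?_
  have hX : (0 : ℝ) < (N : ℝ) + 2 := by positivity
  have hmono : ∀ {E : ℝ} {k : ℕ} {q : ℝ}, 0 ≤ E → 0 ≤ q → k ≤ N →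
      ENNReal.ofReal (E * ((k : ℝ) + 1) ^ q) ≤ ENNReal.ofReal (E * ((N : ℝ) + 2) ^ q) := by
    intro E k q hE hq hk
    have : (k : ℝ) ≤ N := by exact_mod_cast hk
    refine ENNReal.ofReal_le_ofReal ?_
    gcongr
    linarith
  have hq : 0 ≤ (γ - 1) * m := mul_nonneg (by linarith) hm.le
  have hi1 := (hD₁ ij.1).trans (hmono hD₁0 (by linarith) (by omega))
  have hj1 := (hD₁ ij.2).trans (hmono hD₁0 (by linarith) (by omega))
  have hi2 := (hD ij.1).trans (hmono hD0 hq (by omega))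
  have hj2 := (hD ij.2).trans (hmono hD0 hq (by omega))
  rw [lintegral_ofReal_rpow_eq hμ0 (by linarith) hint,
    lintegral_ofReal_rpow_eq hμ0 (by linarith) hint',
    lintegral_ofReal_rpow_eq hμ0 zero_le_one (by simpa using hμ), ← hmdef,
    ← hbdef]
  refine add_le_add le_rfl ?_
  have hpow : ((N : ℝ) + 2) ^ (γ * m) = ((N : ℝ) + 2) ^ ((γ - 1) * m) * ((N : ℝ) + 2) ^ (1 * m) := by
    rw [← Real.rpow_add hX]
    congr 1
    ring
  calc _ ≤ ENNReal.ofReal (γ * 2 ^ (γ - 1)) *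
        (ENNReal.ofReal (D * ((N : ℝ) + 2) ^ ((γ - 1) * m)) *
          (ENNReal.ofReal m * ENNReal.ofReal (D₁ * ((N : ℝ) + 2) ^ (1 * m))) +
        ENNReal.ofReal (D₁ * ((N : ℝ) + 2) ^ (1 * m)) *
          (ENNReal.ofReal b * ENNReal.ofReal (D * ((N : ℝ) + 2) ^ ((γ - 1) * m)))) := by
        gcongr
    _ = _ := by
        rw [← ENNReal.ofReal_mul hm.le, ← ENNReal.ofReal_mul hb,
          ← ENNReal.ofReal_mul (by positivity), ← ENNReal.ofReal_mul (by positivity),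
          ← ENNReal.ofReal_add (by positivity) (by positivity), ← ENNReal.ofReal_mul hC, hpow]
        congr 1
        ring

lemma hasMomentGrowth_of_sub_one [IsProbabilityMeasure P] [IsProbabilityMeasure μ]
    (W : RWES P p ν μ) (hμ0 : ∀ᵐ x ∂μ, 0 ≤ x) (hμ : Integrable (fun x : ℝ => x) μ)
    (hm : 0 < echoMoment μ 1) {γ : ℝ} (hγ : 1 < γ) (hint : Integrable (fun x : ℝ => x ^ γ) μ)
    (hint' : Integrable (fun x : ℝ => x ^ (γ - 1)) μ)
    (hlt : echoMoment μ γ < γ * echoMoment μ 1) (hG : W.HasMomentGrowth (γ - 1)) :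
    W.HasMomentGrowth γ := by
  obtain ⟨B, hB, hrec⟩ := W.walkMoment_recursion hμ0 hμ hm hγ hint hint' hG
  have hc : 0 ≤ echoMoment μ γ := echoMoment_nonneg hμ0 _
  -- Finiteness is settled first, by the same recursion, so that it can then be read in the real
  -- numbers.
  have hfin : ∀ n, W.walkMoment γ (n + 1) ≠ ∞ := by
    intro n
    induction n using Nat.strong_induction_on with
    | _ n ih =>
      cases n with
      | zero => simp [walkMoment_one_eq]
      | succ N =>
        intro htop
        have h := hrec N
        rw [htop, ENNReal.mul_top (by simp), top_le_iff] at h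
        refine ENNReal.sum_ne_top.2 (fun ij hij => ?_) h
        have hN : ij.1 + ij.2 = N := Finset.HasAntidiagonal.mem_antidiagonal.1 hij
        exact ENNReal.add_ne_top.2 ⟨ENNReal.add_ne_top.2 ⟨ih _ (by omega),
          ENNReal.mul_ne_top ENNReal.ofReal_ne_top (ih _ (by omega))⟩, ENNReal.ofReal_ne_top⟩
  set e : ℕ → ℝ := fun n => (W.walkMoment γ (n + 1)).toReal with he
  have he0 : ∀ n, 0 ≤ e n := fun n => ENNReal.toReal_nonneg
  have hee : ∀ n, W.walkMoment γ (n + 1) = ENNReal.ofReal (e n) := fun n =>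
    (ENNReal.ofReal_toReal (hfin n)).symm
  obtain ⟨D, hD⟩ := exists_le_mul_rpow_of_average_le he0 hc hlt hB (fun N => by
    have h := hrec N
    set X : ℝ := ((N : ℝ) + 2) ^ (γ * echoMoment μ 1) with hX
    have hX0 : 0 ≤ X := by positivity
    have h1 : ((N : ℝ≥0∞) + 1) = ENNReal.ofReal ((N : ℝ) + 1) := by
      rw [ENNReal.ofReal_add (by positivity) zero_le_one]; simp
    have h2 : ∀ ij : ℕ × ℕ, W.walkMoment γ (ij.1 + 1) +
        ENNReal.ofReal (echoMoment μ γ) * W.walkMoment γ (ij.2 + 1) + ENNReal.ofReal (B * X) =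
        ENNReal.ofReal (e ij.1 + echoMoment μ γ * e ij.2 + B * X) := by
      intro ij
      have := he0 ij.1
      have := he0 ij.2
      rw [hee, hee, ENNReal.ofReal_add (by positivity) (by positivity),
        ENNReal.ofReal_add (by positivity) (by positivity), ENNReal.ofReal_mul hc]
    have hpos : ∀ ij ∈ Finset.HasAntidiagonal.antidiagonal N,
        0 ≤ e ij.1 + echoMoment μ γ * e ij.2 + B * X := fun ij _ => by
      have := he0 ij.1
      have := he0 ij.2
      positivity
    rw [h1, show N + 2 = (N + 1) + 1 from rfl, hee, ← ENNReal.ofReal_mul (by positivity)] at h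
    simp only [h2] at h
    rw [← ENNReal.ofReal_sum_of_nonneg hpos,
      ENNReal.ofReal_le_ofReal_iff (Finset.sum_nonneg hpos)] at h
    refine h.trans (le_of_eq ?_)
    have h3 : ∑ ij ∈ Finset.HasAntidiagonal.antidiagonal N, e ij.1 =
        ∑ k ∈ Finset.range (N + 1), e k :=
      Finset.Nat.sum_antidiagonal_eq_sum_range_succ_mk (fun ij => e ij.1) N
    have h4 : ∑ ij ∈ Finset.HasAntidiagonal.antidiagonal N, e ij.2 =
        ∑ k ∈ Finset.range (N + 1), e k := by
      rw [← h3]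
      exact Finset.Nat.sum_antidiagonal_swap (f := fun ij => e ij.1)
    rw [Finset.sum_add_distrib, Finset.sum_add_distrib, ← Finset.mul_sum, h3, h4,
      Finset.sum_const, Finset.Nat.card_antidiagonal, nsmul_eq_mul]
    push_cast
    ring)
  refine ⟨D, ?_, fun n => ?_⟩
  · have := (he0 0).trans (hD 0)
    simpa using this
  · rw [hee]
    exact ENNReal.ofReal_le_ofReal (hD n)

theorem hasMomentGrowth [IsProbabilityMeasure P] [IsProbabilityMeasure μ]
    (W : RWES P p ν μ) (hμ0 : ∀ᵐ x ∂μ, 0 ≤ x) (hμ : Integrable (fun x : ℝ => x) μ)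
    (hm : 0 < echoMoment μ 1) {γ : ℝ} (hγ : 1 < γ) (hint : Integrable (fun x : ℝ => x ^ γ) μ)
    (hlt : echoMoment μ γ < γ * echoMoment μ 1) : W.HasMomentGrowth γ := by
  -- Induction in unit steps of the exponent, starting from (0,1]. Downward closure of Λ makes every
  -- intermediate exponent above 1 admissible.
  have key : ∀ k : ℕ, ∀ δ : ℝ, 0 < δ → δ ≤ γ → δ ≤ k + 1 → W.HasMomentGrowth δ := by
    intro k
    induction k with
    | zero =>
      intro δ h0 _ h1
      exact W.hasMomentGrowth_of_le_one hμ0 hμ hm h0 (by simpa using h1)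
    | succ k ih =>
      intro δ h0 hδγ h1
      rcases le_or_gt δ 1 with h | h
      · exact W.hasMomentGrowth_of_le_one hμ0 hμ hm h0 h
      · obtain ⟨h2, h3⟩ := echoExponents_of_le hμ0 hμ hγ hint hlt h hδγ
        have h4 : Integrable (fun x : ℝ => x ^ (δ - 1)) μ := by
          rcases le_or_gt (δ - 1) 1 with h5 | h5
          · exact integrable_rpow_of_le_one hμ0 hμ (by linarith) h5
          · exact integrable_rpow_of_le hμ0 hμ h5.le (by linarith) hγ hint
        push_cast at h1
        exact W.hasMomentGrowth_of_sub_one hμ0 hμ hm h h2 h4 h3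
          (ih _ (by linarith) (by linarith) (by linarith))
  obtain ⟨k, hk⟩ := exists_nat_ge γ
  exact key k γ (by linarith) le_rfl (by linarith)

/-- Boundedness in `L^γ` of the normalized walk. -/
theorem exists_eLpNorm_normWalk_le [IsProbabilityMeasure P] [IsProbabilityMeasure μ]
    (W : RWES P p ν μ) (hμ0 : ∀ᵐ x ∂μ, 0 ≤ x) (hμ : Integrable (fun x : ℝ => x) μ)
    (hm : 0 < echoMoment μ 1) {γ : ℝ} (hγ : 1 < γ) (hint : Integrable (fun x : ℝ => x ^ γ) μ)
    (hlt : echoMoment μ γ < γ * echoMoment μ 1) :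
    ∃ R : NNReal, ∀ n, eLpNorm (W.normWalk n) (ENNReal.ofReal γ) P ≤ R := by
  obtain ⟨D, hD0, hD⟩ := W.hasMomentGrowth hμ0 hμ hm hγ hint hlt
  have hγ0 : 0 < γ := by linarith
  have hlim := (tendsto_meanWalk_div_rpow hm).inv₀
    (one_div_ne_zero (Real.Gamma_pos_of_pos (by linarith)).ne')
  obtain ⟨A, hA⟩ := hlim.bddAbove_range
  have hA' : ∀ n : ℕ, ((n : ℝ) + 1) ^ echoMoment μ 1 ≤ A * meanWalk (echoMoment μ 1) n := by
    intro n
    have h := hA (Set.mem_range_self n)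
    push_cast at h
    rwa [inv_div, div_le_iff₀ (meanWalk_pos hm.le n)] at h
  have hA0 : 0 ≤ A := by
    by_contra hc
    have h1 := hA' 0
    have h2 := meanWalk_pos hm.le 0
    have h3 : (0 : ℝ) ≤ (((0 : ℕ) : ℝ) + 1) ^ echoMoment μ 1 := by positivity
    nlinarith
  refine ⟨Real.toNNReal (D ^ (1 / γ) * A), fun n => ?_⟩
  have ha := meanWalk_pos hm.le n
  set a := meanWalk (echoMoment μ 1) n
  have h1 : eLpNorm (W.pureWalk (n + 1)) (ENNReal.ofReal γ) P ≤
      ENNReal.ofReal (D ^ (1 / γ) * ((n : ℝ) + 1) ^ echoMoment μ 1) := by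
    rw [eLpNorm_ofReal_eq hγ0]
    have h2 : ∫⁻ ω, ‖W.pureWalk (n + 1) ω‖ₑ ^ γ ∂P = W.walkMoment γ (n + 1) := by
      refine lintegral_congr_ae ?_
      filter_upwards [W.ae_pureWalk_nonneg hμ0] with ω h
      rw [Real.enorm_eq_ofReal (h _)]
    rw [h2]
    refine (ENNReal.rpow_le_rpow (hD n) (by positivity)).trans (le_of_eq ?_)
    rw [ENNReal.ofReal_rpow_of_nonneg (by positivity) (by positivity),
      Real.mul_rpow hD0 (by positivity), ← Real.rpow_mul (by positivity)]
    congr 3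
    field_simp
  have h3 : W.normWalk n = a⁻¹ • W.pureWalk (n + 1) := by
    funext ω
    simp [normWalk, div_eq_inv_mul, a]
  rw [h3, eLpNorm_const_smul, Real.enorm_eq_ofReal (by positivity)]
  refine (mul_le_mul_right h1 _).trans ?_
  rw [← ENNReal.ofReal_mul (by positivity)]
  refine ENNReal.ofReal_le_ofReal ?_
  rw [inv_mul_le_iff₀ ha]
  calc D ^ (1 / γ) * ((n : ℝ) + 1) ^ echoMoment μ 1 ≤ D ^ (1 / γ) * (A * a) := by
        gcongr
        exact hA' n
    _ = a * (D ^ (1 / γ) * A) := by ring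

end RWES

/-! ### Quantitative subadditivity of powers and the derivative of γ ↦ m_γ at 1. -/

/-- For y ≤ x, Bernoulli gives (x+y)^θ ≤ x^θ + θ y^θ, and y^θ ≥ min(1, y). The defect is linear in 1
- θ, so it survives division by 1 - θ as θ ↑ 1. -/
lemma add_rpow_add_min_le {x y θ : ℝ} (hx : 0 ≤ x) (hy : 0 ≤ y) (h0 : 0 < θ) (h1 : θ ≤ 1) :
    (1 - θ) * min 1 (min x y) + (x + y) ^ θ ≤ x ^ θ + y ^ θ := by
  wlog hxy : y ≤ x generalizing x y
  · have := this hy hx (le_of_not_ge hxy)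
    rwa [min_comm y x, add_comm y x, add_comm (y ^ θ)] at this
  rw [min_eq_right hxy]
  rcases hy.eq_or_lt with rfl | hy0
  · simp [h0.ne']
  have hx0 : 0 < x := hy0.trans_le hxy
  have h2 := rpow_one_add_le_one_add_mul_self (s := y / x) (p := θ)
    (by have : 0 ≤ y / x := by positivity
        linarith) h0.le h1
  have h3 : 1 + y / x = (x + y) / x := by field_simp
  rw [h3, Real.div_rpow (by positivity) hx, div_le_iff₀ (by positivity)] at h2
  have h4 : θ * (y / x) * x ^ θ ≤ θ * y ^ θ := by
    have h5 : y / x * x ^ θ ≤ y ^ θ := by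
      have h6 : (y / x) ^ (1 : ℝ) ≤ (y / x) ^ θ :=
        Real.rpow_le_rpow_of_exponent_ge (by positivity) ((div_le_one hx0).2 hxy) h1
      rw [Real.rpow_one, Real.div_rpow hy hx] at h6
      calc y / x * x ^ θ ≤ y ^ θ / x ^ θ * x ^ θ := by gcongr
        _ = y ^ θ := by field_simp
    rw [mul_assoc]
    gcongr
  have h7 : min 1 y ≤ y ^ θ := by
    rcases le_total y 1 with h | h
    · rw [min_eq_right h]
      simpa using Real.rpow_le_rpow_of_exponent_ge hy0 h h1
    · rw [min_eq_left h]
      exact Real.one_le_rpow h h0.le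
  have h8 : (1 - θ) * min 1 y ≤ (1 - θ) * y ^ θ :=
    mul_le_mul_of_nonneg_left h7 (by linarith)
  linarith

/-- A bound uniform in γ near 1, for differentiating under the integral. Below 1, x^(1/2) |log x| ≤
2; above 1, log x costs a power (α-1)/2, and (1+α)/2 + (α-1)/2 = α. -/
lemma rpow_mul_abs_log_le {x γ α : ℝ} (hx : 0 < x) (hα : 1 < α) (h1 : 1 / 2 ≤ γ)
    (h2 : γ ≤ (1 + α) / 2) : |x ^ γ * Real.log x| ≤ 2 + 2 / (α - 1) * x ^ α := by
  have hα1 : 0 < α - 1 := by linarith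
  have hxα : 0 ≤ 2 / (α - 1) * x ^ α := by positivity
  rcases le_total x 1 with h | h
  · have h3 := (Real.abs_log_mul_self_rpow_lt x (1 / 2) hx h (by norm_num)).le
    rw [abs_mul, abs_of_pos (Real.rpow_pos_of_pos hx _)] at h3 ⊢
    have h4 : x ^ γ ≤ x ^ (1 / 2 : ℝ) := Real.rpow_le_rpow_of_exponent_ge hx h h1
    have h5 := mul_le_mul_of_nonneg_right h4 (abs_nonneg (Real.log x))
    rw [mul_comm |Real.log x|] at h3
    norm_num at h3 h5 ⊢
    linarith
  · have h3 := Real.log_le_rpow_div hx.le (show 0 < (α - 1) / 2 by linarith)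
    have h4 : 0 ≤ Real.log x := Real.log_nonneg h
    rw [abs_of_nonneg (by positivity)]
    calc x ^ γ * Real.log x ≤ x ^ ((1 + α) / 2) * (x ^ ((α - 1) / 2) / ((α - 1) / 2)) := by
          gcongr
      _ = 2 / (α - 1) * (x ^ ((1 + α) / 2) * x ^ ((α - 1) / 2)) := by field_simp
      _ = 2 / (α - 1) * x ^ α := by rw [← Real.rpow_add hx]; congr 2; ring
      _ ≤ _ := by linarith

lemma hasDerivAt_echoMoment {μ : Measure ℝ} [IsFiniteMeasure μ] (hμ0 : ∀ᵐ x ∂μ, 0 ≤ x)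
    (hμ : Integrable (fun x : ℝ => x) μ) {α : ℝ} (hα : 1 < α)
    (hint : Integrable (fun x : ℝ => x ^ α) μ) :
    HasDerivAt (echoMoment μ) (∫ x, x * Real.log x ∂μ) 1 := by
  have hlim : HasDerivAt (fun γ : ℝ => ∫ x, x ^ γ ∂μ) (∫ x : ℝ, x ^ (1 : ℝ) * Real.log x ∂μ) 1 := by
    refine (hasDerivAt_integral_of_dominated_loc_of_deriv_le (μ := μ) (x₀ := (1 : ℝ))
      (s := Set.Ioo (1 / 2) ((1 + α) / 2)) (F := fun γ x => x ^ γ)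
      (F' := fun γ x => x ^ γ * Real.log x) (bound := fun x => 2 + 2 / (α - 1) * x ^ α)
      (Ioo_mem_nhds (by norm_num) (by linarith)) ?_ (by simpa using hμ) ?_ ?_ ?_ ?_).2
    · exact Eventually.of_forall fun γ =>
        (by fun_prop : Measurable fun x : ℝ => x ^ γ).aestronglyMeasurable
    · exact (Measurable.mul (by fun_prop) Real.measurable_log).aestronglyMeasurable
    · filter_upwards [hμ0] with x hx γ hγ
      rcases hx.eq_or_lt with rfl | hx0
      · have : 0 < α - 1 := by linarith
        simp only [Real.log_zero, mul_zero, norm_zero]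
        positivity
      · exact rpow_mul_abs_log_le hx0 hα hγ.1.le hγ.2.le
    · exact (integrable_const _).add (hint.const_mul _)
    · filter_upwards [hμ0] with x hx γ hγ
      rcases hx.eq_or_lt with rfl | hx0
      -- At x = 0 the function γ ↦ 0^γ vanishes near every positive γ, in accordance with the
      -- convention 0 log 0 = 0.
      · rw [Real.log_zero, mul_zero]
        refine (hasDerivAt_const γ (0 : ℝ)).congr_of_eventuallyEq ?_
        filter_upwards [lt_mem_nhds (show (0 : ℝ) < γ by linarith [hγ.1])] with δ hδ
        exact Real.zero_rpow hδ.ne'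
      · exact (Real.hasStrictDerivAt_const_rpow hx0 γ).hasDerivAt
  simp only [Real.rpow_one] at hlim
  exact hlim

/-- `Λ` is not empty when `E[ξ log ξ] < m_1`. -/
lemma exists_echoMoment_lt {μ : Measure ℝ} [IsFiniteMeasure μ] (hμ0 : ∀ᵐ x ∂μ, 0 ≤ x)
    (hμ : Integrable (fun x : ℝ => x) μ) {α : ℝ} (hα : 1 < α)
    (hint : Integrable (fun x : ℝ => x ^ α) μ)
    (hlog : ∫ x, x * Real.log x ∂μ < echoMoment μ 1) :
    ∃ γ, 1 < γ ∧ Integrable (fun x : ℝ => x ^ γ) μ ∧ echoMoment μ γ < γ * echoMoment μ 1 := by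
  have hd := (hasDerivAt_echoMoment hμ0 hμ hα hint).hasDerivWithinAt (s := Set.Ioi 1)
  rw [hasDerivWithinAt_iff_tendsto_slope' (by simp)] at hd
  -- For γ slightly above 1 the slope (m_γ - m_1)/(γ - 1) is below m_1, which rearranges to m_γ < γ
  -- m_1.
  have h1 := hd.eventually_lt_const hlog
  have h2 : ∀ᶠ γ in 𝓝[>] (1 : ℝ), γ ∈ Set.Ioo 1 α := Ioo_mem_nhdsGT hα
  obtain ⟨γ, h1, h2⟩ := (h1.and h2).exists
  refine ⟨γ, h2.1, integrable_rpow_of_le hμ0 hμ h2.1.le h2.2.le hα hint, ?_⟩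
  have h3 : 0 < γ - 1 := by linarith [h2.1]
  rw [slope_def_field, div_lt_iff₀ h3] at h1
  linarith

/-! ### Consequences of the smoothing equation: degeneracy and non-degeneracy. -/

namespace RWES

variable {Ω : Type*} [mΩ : MeasurableSpace Ω] {P : Measure Ω} {p : ℝ} {ν μ : Measure ℝ}

lemma integral_Ioo_rpow {q : ℝ} (hq : 0 ≤ q) : ∫ u in Set.Ioo (0 : ℝ) 1, u ^ q = 1 / (q + 1) := by
  rw [← integral_Ioc_eq_integral_Ioo, ← intervalIntegral.integral_of_le zero_le_one,
    integral_rpow (Or.inl (by linarith))]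
  simp [(show q + 1 ≠ 0 by linarith)]

lemma integral_Ioo_one_sub_rpow {q : ℝ} (hq : 0 ≤ q) :
    ∫ u in Set.Ioo (0 : ℝ) 1, (1 - u) ^ q = 1 / (q + 1) := by
  rw [← integral_Ioo_rpow hq, ← integral_Ioc_eq_integral_Ioo, ← integral_Ioc_eq_integral_Ioo,
    ← intervalIntegral.integral_of_le zero_le_one, ← intervalIntegral.integral_of_le zero_le_one,
    intervalIntegral.integral_comp_sub_left (fun u => u ^ q)]
  simp

/-- A non-integrable function would have integral 0 by default, contradicting the value 1/(q+1). -/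
lemma integrable_Ioo_rpow {q : ℝ} (hq : 0 ≤ q) :
    Integrable (fun u : ℝ => u ^ q) (volume.restrict (Set.Ioo (0 : ℝ) 1)) := by
  by_contra h
  have h1 := integral_undef h
  rw [integral_Ioo_rpow hq, div_eq_zero_iff] at h1
  rcases h1 with h1 | h1 <;> linarith

lemma integrable_Ioo_one_sub_rpow {q : ℝ} (hq : 0 ≤ q) :
    Integrable (fun u : ℝ => (1 - u) ^ q) (volume.restrict (Set.Ioo (0 : ℝ) 1)) := by
  by_contra h
  have h1 := integral_undef h
  rw [integral_Ioo_one_sub_rpow hq, div_eq_zero_iff] at h1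
  rcases h1 with h1 | h1 <;> linarith

/-- The bound x^θ ≤ 1 + x is uniform in θ, as needed when θ tends to 1. -/
lemma integrable_limitWalk_rpow [IsProbabilityMeasure P] (W : RWES P p ν μ)
    (hμ0 : ∀ᵐ x ∂μ, 0 ≤ x) (hμ : Integrable (fun x : ℝ => x) μ) (hm : 0 < echoMoment μ 1)
    {θ : ℝ} (h0 : 0 ≤ θ) (h1 : θ ≤ 1) :
    Integrable (fun ω => W.limitWalk ω ^ θ) P ∧
      ∫ ω, W.limitWalk ω ^ θ ∂P ≤ 1 + ∫ ω, W.limitWalk ω ∂P := by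
  have hZ := W.integrable_limitWalk hμ0 hμ
  have hb : ∀ᵐ ω ∂P, W.limitWalk ω ^ θ ≤ 1 + W.limitWalk ω := by
    filter_upwards [W.ae_limitWalk_nonneg hμ0 hμ hm] with ω hω
    rcases le_total (W.limitWalk ω) 1 with h | h
    · exact (Real.rpow_le_one hω h h0).trans (by linarith)
    · exact (Real.rpow_le_rpow_of_exponent_le h h1).trans (by simp)
  have hi : Integrable (fun ω => W.limitWalk ω ^ θ) P := by
    refine ((integrable_const (1 : ℝ)).add hZ).mono'
      (W.measurable_limitWalk.pow_const θ).aestronglyMeasurable ?_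
    filter_upwards [W.ae_limitWalk_nonneg hμ0 hμ hm, hb] with ω hω hω'
    rw [Real.norm_of_nonneg (Real.rpow_nonneg hω _)]
    exact hω'
  refine ⟨hi, ?_⟩
  have h2 := integral_mono_ae hi ((integrable_const (1 : ℝ)).add hZ) hb
  rw [integral_add' (integrable_const _) hZ] at h2
  simpa using h2

/-- The first summand in the smoothing equation. -/
noncomputable def smoothingLeft (W : RWES P p ν μ) (z : ℝ × Ω × ℝ × Ω) : ℝ :=
  z.1 ^ echoMoment μ 1 * W.limitWalk z.2.1

/-- The second summand in the smoothing equation. -/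
noncomputable def smoothingRight (W : RWES P p ν μ) (z : ℝ × Ω × ℝ × Ω) : ℝ :=
  z.2.2.1 * ((1 - z.1) ^ echoMoment μ 1 * W.limitWalk z.2.2.2)

lemma ae_smoothingLaw [IsProbabilityMeasure P] [IsProbabilityMeasure μ] (W : RWES P p ν μ)
    (hμ0 : ∀ᵐ x ∂μ, 0 ≤ x) (hμ : Integrable (fun x : ℝ => x) μ) (hm : 0 < echoMoment μ 1) :
    ∀ᵐ z ∂(smoothingLaw P μ), z.1 ∈ Set.Ioo (0 : ℝ) 1 ∧ 0 ≤ W.limitWalk z.2.1 ∧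
      0 ≤ z.2.2.1 ∧ 0 ≤ W.limitWalk z.2.2.2 := by
  have hZ := W.ae_limitWalk_nonneg hμ0 hμ hm
  have h1 : ∀ᵐ z ∂(smoothingLaw P μ), z.1 ∈ Set.Ioo (0 : ℝ) 1 :=
    Measure.quasiMeasurePreserving_fst.ae (ae_restrict_mem measurableSet_Ioo)
  have h2 : ∀ᵐ z ∂(smoothingLaw P μ), 0 ≤ W.limitWalk z.2.1 :=
    Measure.quasiMeasurePreserving_snd.ae (Measure.quasiMeasurePreserving_fst.ae hZ)
  have h3 : ∀ᵐ z ∂(smoothingLaw P μ), 0 ≤ z.2.2.1 :=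
    Measure.quasiMeasurePreserving_snd.ae
      (Measure.quasiMeasurePreserving_snd.ae (Measure.quasiMeasurePreserving_fst.ae hμ0))
  have h4 : ∀ᵐ z ∂(smoothingLaw P μ), 0 ≤ W.limitWalk z.2.2.2 :=
    Measure.quasiMeasurePreserving_snd.ae
      (Measure.quasiMeasurePreserving_snd.ae (Measure.quasiMeasurePreserving_snd.ae hZ))
  filter_upwards [h1, h2, h3, h4] with z h1 h2 h3 h4 using ⟨h1, h2, h3, h4⟩

lemma integral_smoothingLeft_rpow [IsProbabilityMeasure P] [IsProbabilityMeasure μ]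
    (W : RWES P p ν μ)
    (hμ0 : ∀ᵐ x ∂μ, 0 ≤ x) (hμ : Integrable (fun x : ℝ => x) μ) (hm : 0 < echoMoment μ 1)
    {θ : ℝ} (h0 : 0 ≤ θ) (h1 : θ ≤ 1) :
    Integrable (fun z => W.smoothingLeft z ^ θ) (smoothingLaw P μ) ∧
    ∫ z, W.smoothingLeft z ^ θ ∂(smoothingLaw P μ) =
      1 / (echoMoment μ 1 * θ + 1) * ∫ ω, W.limitWalk ω ^ θ ∂P := by
  have hq : 0 ≤ echoMoment μ 1 * θ := by positivity
  have hZ := (W.integrable_limitWalk_rpow hμ0 hμ hm h0 h1).1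
  have heq : (fun z => z.1 ^ (echoMoment μ 1 * θ) * W.limitWalk z.2.1 ^ θ) =ᵐ[smoothingLaw P μ]
      fun z => W.smoothingLeft z ^ θ := by
    filter_upwards [W.ae_smoothingLaw hμ0 hμ hm] with z hz
    rw [smoothingLeft, Real.mul_rpow (Real.rpow_nonneg hz.1.1.le _) hz.2.1,
      ← Real.rpow_mul hz.1.1.le]
  constructor
  · exact ((integrable_Ioo_rpow hq).mul_prod (hZ.comp_fst (μ.prod P))).congr heq
  · rw [← integral_congr_ae heq]
    refine (integral_prod_mul (fun u : ℝ => u ^ (echoMoment μ 1 * θ))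
      (fun w : Ω × ℝ × Ω => W.limitWalk w.1 ^ θ)).trans ?_
    rw [integral_Ioo_rpow hq, integral_fun_fst (fun ω => W.limitWalk ω ^ θ)]
    simp

lemma integral_smoothingRight_rpow [IsProbabilityMeasure P] [IsProbabilityMeasure μ]
    (W : RWES P p ν μ)
    (hμ0 : ∀ᵐ x ∂μ, 0 ≤ x) (hμ : Integrable (fun x : ℝ => x) μ) (hm : 0 < echoMoment μ 1)
    {θ : ℝ} (h0 : 0 ≤ θ) (h1 : θ ≤ 1) :
    Integrable (fun z => W.smoothingRight z ^ θ) (smoothingLaw P μ) ∧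
    ∫ z, W.smoothingRight z ^ θ ∂(smoothingLaw P μ) =
      1 / (echoMoment μ 1 * θ + 1) * (echoMoment μ θ * ∫ ω, W.limitWalk ω ^ θ ∂P) := by
  have hq : 0 ≤ echoMoment μ 1 * θ := by positivity
  have hZ := (W.integrable_limitWalk_rpow hμ0 hμ hm h0 h1).1
  have hx := integrable_rpow_of_le_one hμ0 hμ h0 h1
  have heq : (fun z => (1 - z.1) ^ (echoMoment μ 1 * θ) *
      (z.2.2.1 ^ θ * W.limitWalk z.2.2.2 ^ θ)) =ᵐ[smoothingLaw P μ]
      fun z => W.smoothingRight z ^ θ := by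
    filter_upwards [W.ae_smoothingLaw hμ0 hμ hm] with z hz
    have hu : 0 ≤ 1 - z.1 := by linarith [hz.1.2]
    rw [smoothingRight, Real.mul_rpow hz.2.2.1 (mul_nonneg (Real.rpow_nonneg hu _) hz.2.2.2),
      Real.mul_rpow (Real.rpow_nonneg hu _) hz.2.2.2, ← Real.rpow_mul hu]
    ring
  constructor
  · exact ((integrable_Ioo_one_sub_rpow hq).mul_prod ((hx.mul_prod hZ).comp_snd P)).congr heq
  · rw [← integral_congr_ae heq]
    refine (integral_prod_mul (fun u : ℝ => (1 - u) ^ (echoMoment μ 1 * θ))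
      (fun w : Ω × ℝ × Ω => w.2.1 ^ θ * W.limitWalk w.2.2 ^ θ)).trans ?_
    rw [integral_Ioo_one_sub_rpow hq,
      integral_fun_snd (fun w : ℝ × Ω => w.1 ^ θ * W.limitWalk w.2 ^ θ),
      integral_prod_mul (fun x : ℝ => x ^ θ) (fun ω => W.limitWalk ω ^ θ)]
    simp [echoMoment]

/-- Fractional moments of both sides of the smoothing equation. -/
lemma integral_min_smoothing_le [IsProbabilityMeasure P] [IsProbabilityMeasure μ]
    (W : RWES P p ν μ)
    (hμ0 : ∀ᵐ x ∂μ, 0 ≤ x) (hμ : Integrable (fun x : ℝ => x) μ) (hm : 0 < echoMoment μ 1)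
    {θ : ℝ} (h0 : 0 < θ) (h1 : θ < 1) :
    ∫ z, min 1 (min (W.smoothingLeft z) (W.smoothingRight z)) ∂(smoothingLaw P μ) ≤
      (1 + ∫ ω, W.limitWalk ω ∂P) *
        max 0 ((echoMoment μ θ - θ * echoMoment μ 1) / (1 - θ)) := by
  obtain ⟨hZi, hZ1⟩ := W.integrable_limitWalk_rpow hμ0 hμ hm h0.le h1.le
  obtain ⟨hli, hl⟩ := W.integral_smoothingLeft_rpow hμ0 hμ hm h0.le h1.le
  obtain ⟨hri, hr⟩ := W.integral_smoothingRight_rpow hμ0 hμ hm h0.le h1.le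
  have hlaw := W.map_limitWalk_eq_map_smoothing hμ0 hμ hm
  have hpow : Measurable fun x : ℝ => x ^ θ := by fun_prop
  set m := echoMoment μ 1
  set E := ∫ ω, W.limitWalk ω ^ θ ∂P with hE
  have hsi : Integrable (fun z => W.smoothing z ^ θ) (smoothingLaw P μ) := by
    have h2 : Integrable (fun x : ℝ => x ^ θ) (P.map W.limitWalk) :=
      (integrable_map_measure hpow.aestronglyMeasurable
        W.measurable_limitWalk.aemeasurable).2 hZi
    rw [hlaw] at h2
    exact h2.comp_measurable W.measurable_smoothing
  have hs : ∫ z, W.smoothing z ^ θ ∂(smoothingLaw P μ) = E := by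
    rw [hE, ← integral_map (f := fun x : ℝ => x ^ θ) W.measurable_limitWalk.aemeasurable
      hpow.aestronglyMeasurable, hlaw,
      integral_map W.measurable_smoothing.aemeasurable hpow.aestronglyMeasurable]
  have hE0 : 0 ≤ E := integral_nonneg_of_ae
    ((W.ae_limitWalk_nonneg hμ0 hμ hm).mono fun ω h => Real.rpow_nonneg h _)
  set I := ∫ z, min 1 (min (W.smoothingLeft z) (W.smoothingRight z)) ∂(smoothingLaw P μ) with hI
  have hmin : Integrable (fun z => min 1 (min (W.smoothingLeft z) (W.smoothingRight z)))
      (smoothingLaw P μ) := by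
    have hmeas : Measurable fun z => min 1 (min (W.smoothingLeft z) (W.smoothingRight z)) := by
      have := W.measurable_limitWalk
      unfold smoothingLeft smoothingRight
      fun_prop
    refine Integrable.of_bound hmeas.aestronglyMeasurable 1 ?_
    filter_upwards [W.ae_smoothingLaw hμ0 hμ hm] with z hz
    have hu : 0 ≤ 1 - z.1 := by linarith [hz.1.2]
    have ha : 0 ≤ W.smoothingLeft z := mul_nonneg (Real.rpow_nonneg hz.1.1.le _) hz.2.1
    have hb : 0 ≤ W.smoothingRight z :=
      mul_nonneg hz.2.2.1 (mul_nonneg (Real.rpow_nonneg hu _) hz.2.2.2)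
    rw [Real.norm_of_nonneg (le_min zero_le_one (le_min ha hb))]
    exact min_le_left _ _
  -- The smoothing equation gives the left-hand combination its term E; the right side comes from
  -- independence and E[u^(mθ)] = 1/(mθ+1).
  have hle : (1 - θ) * I + E ≤ 1 / (m * θ + 1) * E + 1 / (m * θ + 1) * (echoMoment μ θ * E) := by
    rw [← hl, ← hr, ← hs, hI, ← integral_const_mul, ← integral_add (hmin.const_mul _) hsi,
      ← integral_add hli hri]
    refine integral_mono_ae ((hmin.const_mul _).add hsi) (hli.add hri) ?_
    filter_upwards [W.ae_smoothingLaw hμ0 hμ hm] with z hz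
    have hu : 0 ≤ 1 - z.1 := by linarith [hz.1.2]
    exact add_rpow_add_min_le (mul_nonneg (Real.rpow_nonneg hz.1.1.le _) hz.2.1)
      (mul_nonneg hz.2.2.1 (mul_nonneg (Real.rpow_nonneg hu _) hz.2.2.2)) h0 h1.le
  have hθ : 0 < 1 - θ := by linarith
  have hmθ : 0 < m * θ := by positivity
  set q := (echoMoment μ θ - θ * m) / (1 - θ) with hq
  have h2 : I ≤ E / (m * θ + 1) * q := by
    have h3 : E / (m * θ + 1) * q =
        (1 / (m * θ + 1) * E + 1 / (m * θ + 1) * (echoMoment μ θ * E) - E) / (1 - θ) := by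
      rw [hq]
      field_simp
      ring
    rw [h3, le_div_iff₀ hθ]
    linarith
  have h4 : E / (m * θ + 1) ≤ 1 + ∫ ω, W.limitWalk ω ∂P :=
    (div_le_self hE0 (by linarith)).trans hZ1
  -- q may be negative, so it is replaced by its positive part before its coefficient is enlarged.
  calc I ≤ E / (m * θ + 1) * q := h2
    _ ≤ E / (m * θ + 1) * max 0 q := by
        gcongr
        exact le_max_right _ _
    _ ≤ _ := by
        gcongr

/-- Degeneracy of the limit when `E[ξ log ξ] ≥ m_1`. -/
theorem limitWalk_ae_eq_zero [IsProbabilityMeasure P] [IsProbabilityMeasure μ]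
    (W : RWES P p ν μ)
    (hμ0 : ∀ᵐ x ∂μ, 0 ≤ x) (hμ : Integrable (fun x : ℝ => x) μ) (hm : 0 < echoMoment μ 1)
    {α : ℝ} (hα : 1 < α) (hint : Integrable (fun x : ℝ => x ^ α) μ)
    (hlog : echoMoment μ 1 ≤ ∫ x, x * Real.log x ∂μ) : ∀ᵐ ω ∂P, W.limitWalk ω = 0 := by
  have hmin0 : ∀ᵐ z ∂(smoothingLaw P μ),
      0 ≤ min 1 (min (W.smoothingLeft z) (W.smoothingRight z)) := by
    filter_upwards [W.ae_smoothingLaw hμ0 hμ hm] with z hz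
    have hu : 0 ≤ 1 - z.1 := by linarith [hz.1.2]
    exact le_min zero_le_one (le_min (mul_nonneg (Real.rpow_nonneg hz.1.1.le _) hz.2.1)
      (mul_nonneg hz.2.2.1 (mul_nonneg (Real.rpow_nonneg hu _) hz.2.2.2)))
  have hmeas : Measurable fun z => min 1 (min (W.smoothingLeft z) (W.smoothingRight z)) := by
    have := W.measurable_limitWalk
    unfold smoothingLeft smoothingRight
    fun_prop
  have hmini : Integrable (fun z => min 1 (min (W.smoothingLeft z) (W.smoothingRight z)))
      (smoothingLaw P μ) := by
    refine Integrable.of_bound hmeas.aestronglyMeasurable 1 ?_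
    filter_upwards [hmin0] with z hz
    rw [Real.norm_of_nonneg hz]
    exact min_le_left _ _
  have hlim : Tendsto (fun θ => (1 + ∫ ω, W.limitWalk ω ∂P) *
      max 0 ((echoMoment μ θ - θ * echoMoment μ 1) / (1 - θ))) (𝓝[<] 1) (𝓝 0) := by
    have hd := (hasDerivAt_echoMoment hμ0 hμ hα hint).hasDerivWithinAt (s := Set.Iio 1)
    rw [hasDerivWithinAt_iff_tendsto_slope' (by simp)] at hd
    -- The quotient equals m_1 minus the slope of γ ↦ m_γ between θ and 1, so its limit is
    -- nonpositive in the present case.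
    have h1 : Tendsto (fun θ => (echoMoment μ θ - θ * echoMoment μ 1) / (1 - θ)) (𝓝[<] 1)
        (𝓝 (echoMoment μ 1 - ∫ x, x * Real.log x ∂μ)) := by
      refine (hd.const_sub (echoMoment μ 1)).congr' ?_
      filter_upwards [self_mem_nhdsWithin] with θ hθ
      have h2 : θ - 1 ≠ 0 := by
        have : θ < 1 := hθ
        linarith
      have h3 : 1 - θ ≠ 0 := fun h => h2 (by linarith)
      rw [slope_def_field]
      field_simp
      ring
    have h2 := ((tendsto_const_nhds (x := (0 : ℝ))).max h1).const_mul
      (1 + ∫ ω, W.limitWalk ω ∂P)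
    rwa [max_eq_left (by linarith), mul_zero] at h2
  have hI : ∫ z, min 1 (min (W.smoothingLeft z) (W.smoothingRight z)) ∂(smoothingLaw P μ) ≤ 0 := by
    refine ge_of_tendsto hlim ?_
    filter_upwards [Ioo_mem_nhdsLT (show (0 : ℝ) < 1 by norm_num)] with θ hθ
    exact W.integral_min_smoothing_le hμ0 hμ hm hθ.1 hθ.2
  have hzero := (integral_eq_zero_iff_of_nonneg_ae hmin0 hmini).1
    (le_antisymm hI (integral_nonneg_of_ae hmin0))
  have hprod : ∀ᵐ z ∂(smoothingLaw P μ), W.limitWalk z.2.1 * (z.2.2.1 * W.limitWalk z.2.2.2) = 0 := by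
    filter_upwards [hzero, W.ae_smoothingLaw hμ0 hμ hm] with z h hz
    have hu1 : 0 < z.1 ^ echoMoment μ 1 := Real.rpow_pos_of_pos hz.1.1 _
    have hu2 : 0 < (1 - z.1) ^ echoMoment μ 1 := Real.rpow_pos_of_pos (by linarith [hz.1.2]) _
    have h' : min 1 (min (W.smoothingLeft z) (W.smoothingRight z)) = 0 := h
    rcases min_choice 1 (min (W.smoothingLeft z) (W.smoothingRight z)) with h1 | h1
    · rw [h'] at h1
      exact absurd h1 (by norm_num)
    · rw [h'] at h1
      rcases min_choice (W.smoothingLeft z) (W.smoothingRight z) with h2 | h2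
      · rw [← h1, smoothingLeft, eq_comm, mul_eq_zero] at h2
        rw [h2.resolve_left hu1.ne', zero_mul]
      · rw [← h1, smoothingRight, eq_comm, mul_eq_zero, mul_eq_zero] at h2
        rcases h2 with h2 | h2
        · rw [h2, zero_mul, mul_zero]
        · rw [h2.resolve_left hu2.ne', mul_zero, mul_zero]
  obtain ⟨u, hu⟩ := (Measure.ae_ae_of_ae_prod hprod).exists
  -- Since L' · ξL'' = 0 almost surely and the three factors are independent, taking expectations
  -- gives E[L] · m_1 · E[L] = 0.
  have hprod0 : ∫ w, W.limitWalk w.1 * (w.2.1 * W.limitWalk w.2.2) ∂(P.prod (μ.prod P)) = 0 := by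
    rw [integral_congr_ae hu]
    simp
  rw [integral_prod_mul W.limitWalk (fun w : ℝ × Ω => w.1 * W.limitWalk w.2),
    integral_prod_mul (fun x : ℝ => x) W.limitWalk, ← echoMoment_one] at hprod0
  have hZ0 : ∫ ω, W.limitWalk ω ∂P = 0 := by
    rcases mul_eq_zero.1 hprod0 with h | h
    · exact h
    · exact (mul_eq_zero.1 h).resolve_left hm.ne'
  exact (integral_eq_zero_iff_of_nonneg_ae (W.ae_limitWalk_nonneg hμ0 hμ hm)
    (W.integrable_limitWalk hμ0 hμ)).1 hZ0

/-- A limit that is almost surely a nonzero constant forces the echoes to be trivial. -/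
theorem echo_eq_one_of_limitWalk_const [IsProbabilityMeasure P] [IsProbabilityMeasure μ]
    (W : RWES P p ν μ)
    (hμ0 : ∀ᵐ x ∂μ, 0 ≤ x) (hμ : Integrable (fun x : ℝ => x) μ) (hm : 0 < echoMoment μ 1)
    {c : ℝ} (hc : c ≠ 0) (h : ∀ᵐ ω ∂P, W.limitWalk ω = c) : ∀ᵐ x ∂μ, x = 1 := by
  have h1 : ∀ᵐ z ∂(smoothingLaw P μ), W.smoothing z = c := by
    refine ae_of_ae_map W.measurable_smoothing.aemeasurable (p := fun x => x = c) ?_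
    rw [← W.map_limitWalk_eq_map_smoothing hμ0 hμ hm]
    exact (ae_map_iff W.measurable_limitWalk.aemeasurable (measurableSet_singleton c)).2 h
  have h2 : ∀ᵐ z ∂(smoothingLaw P μ), W.limitWalk z.2.1 = c :=
    Measure.quasiMeasurePreserving_snd.ae (Measure.quasiMeasurePreserving_fst.ae h)
  have h3 : ∀ᵐ z ∂(smoothingLaw P μ), W.limitWalk z.2.2.2 = c :=
    Measure.quasiMeasurePreserving_snd.ae
      (Measure.quasiMeasurePreserving_snd.ae (Measure.quasiMeasurePreserving_snd.ae h))
  have h4 : ∀ᵐ z ∂(smoothingLaw P μ),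
      z.1 ^ echoMoment μ 1 + z.2.2.1 * (1 - z.1) ^ echoMoment μ 1 = 1 := by
    filter_upwards [h1, h2, h3] with z h1 h2 h3
    rw [smoothing, h2, h3] at h1
    refine mul_right_cancel₀ hc ?_
    linear_combination h1
  have h5 : ∀ᵐ u ∂(volume.restrict (Set.Ioo (0 : ℝ) 1)), ∀ᵐ y ∂μ,
      u ^ echoMoment μ 1 + y * (1 - u) ^ echoMoment μ 1 = 1 := by
    filter_upwards [Measure.ae_ae_of_ae_prod h4] with u hu
    obtain ⟨ω, hω⟩ := (Measure.ae_ae_of_ae_prod hu).exists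
    filter_upwards [Measure.ae_ae_of_ae_prod hω] with y hy
    exact hy.exists.choose_spec
  have hmeas : MeasurableSet {z : ℝ × ℝ |
      z.1 ^ echoMoment μ 1 + z.2 * (1 - z.1) ^ echoMoment μ 1 = 1} :=
    measurableSet_eq_fun (by fun_prop) measurable_const
  have h6 : ∀ᵐ y ∂μ, ∀ᵐ u ∂(volume.restrict (Set.Ioo (0 : ℝ) 1)),
      u ^ echoMoment μ 1 + y * (1 - u) ^ echoMoment μ 1 = 1 := Measure.ae_ae_comm hmeas |>.1 h5
  filter_upwards [h6] with y hy
  have hcont : Continuous fun u : ℝ => u ^ echoMoment μ 1 + y * (1 - u) ^ echoMoment μ 1 := by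
    have h7 := Real.continuous_rpow_const hm.le
    exact h7.add (continuous_const.mul (h7.comp (by fun_prop)))
  -- The equation holds for almost every u in (0,1), hence for some u arbitrarily close to 0. By
  -- continuity it holds at u = 0, where it reads y = 1 because 0^m = 0.
  have hfreq : ∃ᶠ u in 𝓝 (0 : ℝ), u ^ echoMoment μ 1 + y * (1 - u) ^ echoMoment μ 1 = 1 := by
    rw [Metric.nhds_basis_ball.frequently_iff]
    intro ε hε
    have hpos : 0 < (volume.restrict (Set.Ioo (0 : ℝ) 1)) (Set.Ioo 0 (min ε 1)) := by
      rw [Measure.restrict_apply measurableSet_Ioo,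
        Set.inter_eq_left.2 (Set.Ioo_subset_Ioo_right (min_le_right _ _))]
      simp [hε]
    obtain ⟨u, hu1, hu2⟩ := (hy.and_frequently (frequently_ae_mem_iff.2 hpos.ne')).exists
    refine ⟨u, ?_, hu1⟩
    rw [Metric.mem_ball, Real.dist_0_eq_abs, abs_of_pos hu2.1]
    exact hu2.2.trans_le (min_le_left _ _)
  have hclosed : IsClosed {u : ℝ | u ^ echoMoment μ 1 + y * (1 - u) ^ echoMoment μ 1 = 1} :=
    isClosed_eq hcont continuous_const
  have h0 := hclosed.mem_of_frequently_of_tendsto hfreq tendsto_id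
  simpa [Real.zero_rpow hm.ne'] using h0

end RWES

/-! ### Transfer to the normalization n^m and conclusion. -/

namespace RWES

variable {Ω : Type*} [mΩ : MeasurableSpace Ω] {P : Measure Ω} {p : ℝ} {ν μ : Measure ℝ}

lemma echoMoment_one_pos [IsProbabilityMeasure μ] (hμ0 : ∀ᵐ x ∂μ, 0 ≤ x)
    (hμ : Integrable (fun x : ℝ => x) μ) (hμ_zero : μ {0} < 1) : 0 < echoMoment μ 1 := by
  refine (echoMoment_nonneg hμ0 1).lt_of_ne fun h => hμ_zero.ne ?_
  rw [echoMoment_one, eq_comm, integral_eq_zero_iff_of_nonneg_ae hμ0 hμ] at h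
  exact (prob_compl_eq_zero_iff (measurableSet_singleton 0)).1 h

lemma pureWalk_div_rpow_eq (W : RWES P p ν μ) (hm : 0 ≤ echoMoment μ 1) (n : ℕ) :
    (fun ω => W.pureWalk (n + 1) ω / ((n + 1 : ℕ) : ℝ) ^ echoMoment μ 1) =
      (meanWalk (echoMoment μ 1) n / ((n + 1 : ℕ) : ℝ) ^ echoMoment μ 1) • W.normWalk n := by
  funext ω
  have := (meanWalk_pos hm n).ne'
  simp only [Pi.smul_apply, smul_eq_mul, normWalk]
  field_simp

/-- Convergence in `L^γ` for `γ ∈ Λ`, and the mean of the limit. -/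
theorem tendsto_eLpNorm_pureWalk [IsProbabilityMeasure P] [IsProbabilityMeasure μ]
    (W : RWES P p ν μ) (hμ0 : ∀ᵐ x ∂μ, 0 ≤ x) (hμ : Integrable (fun x : ℝ => x) μ)
    (hm : 0 < echoMoment μ 1) {γ : ℝ} (hγ : 1 < γ) (hint : Integrable (fun x : ℝ => x ^ γ) μ)
    (hlt : echoMoment μ γ < γ * echoMoment μ 1) :
    MemLp W.limitWalk (ENNReal.ofReal γ) P ∧
    (∀ n : ℕ, MemLp (fun ω => W.pureWalk n ω / (n : ℝ) ^ echoMoment μ 1)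
      (ENNReal.ofReal γ) P) ∧
    Tendsto (fun n : ℕ => eLpNorm
      (fun ω => W.pureWalk n ω / (n : ℝ) ^ echoMoment μ 1 - W.limitWalk ω) (ENNReal.ofReal γ) P)
      atTop (𝓝 0) ∧
    ∫ ω, W.limitWalk ω ∂P = 1 / Real.Gamma (1 + echoMoment μ 1) := by
  obtain ⟨R, hR⟩ := W.exists_eLpNorm_normWalk_le hμ0 hμ hm hγ hint hlt
  have hM := W.martingale_normWalk hμ0 hμ
  obtain ⟨hmem, hconv, hmean⟩ := Martingale.tendsto_eLpNorm_limitProcess hM hγ hR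
  set g := Filtration.limitProcess W.normWalk W.filtration P with hg
  have hnorm : ∀ n, MemLp (W.normWalk n) (ENNReal.ofReal γ) P := fun n =>
    ⟨(hM.integrable n).1, (hR n).trans_lt ENNReal.coe_lt_top⟩
  have hL : W.limitWalk = (1 / Real.Gamma (1 + echoMoment μ 1)) • g := by
    funext ω
    simp [limitWalk, hg, div_eq_inv_mul]
  refine ⟨?_, ?_, ?_, ?_⟩
  · rw [hL]
    exact hmem.const_smul _
  · intro n
    cases n with
    | zero => simp
    | succ n =>
      rw [W.pureWalk_div_rpow_eq hm.le]
      exact (hnorm n).const_smul _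
  · refine (tendsto_add_atTop_iff_nat 1).1 ?_
    set c : ℕ → ℝ := fun n => meanWalk (echoMoment μ 1) n / ((n + 1 : ℕ) : ℝ) ^ echoMoment μ 1
      with hcdef
    set l := 1 / Real.Gamma (1 + echoMoment μ 1) with hl
    have hc : Tendsto c atTop (𝓝 l) := tendsto_meanWalk_div_rpow hm
    -- Writing M_n for the martingale and g for its limit, c_n M_n - l g = c_n (M_n - g) + (c_n - l)
    -- g.
    have hbound : Tendsto (fun n => ‖c n‖ₑ * eLpNorm (W.normWalk n - g) (ENNReal.ofReal γ) P +
        ‖c n - l‖ₑ * eLpNorm g (ENNReal.ofReal γ) P) atTop (𝓝 0) := by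
      have h1 := ENNReal.Tendsto.mul hc.enorm (Or.inr ENNReal.zero_ne_top) hconv
        (Or.inr enorm_ne_top)
      have h2 := ENNReal.Tendsto.mul_const (hc.sub_const l).enorm
        (Or.inr hmem.eLpNorm_ne_top)
      rw [sub_self, enorm_zero, zero_mul] at h2
      rw [mul_zero] at h1
      simpa using h1.add h2
    refine tendsto_of_tendsto_of_tendsto_of_le_of_le tendsto_const_nhds hbound
      (fun _ => zero_le) fun n => ?_
    have heq : (fun ω => W.pureWalk (n + 1) ω / ((n + 1 : ℕ) : ℝ) ^ echoMoment μ 1 -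
        W.limitWalk ω) = c n • (W.normWalk n - g) + (c n - l) • g := by
      funext ω
      have h3 := congrFun (W.pureWalk_div_rpow_eq hm.le n) ω
      rw [h3, hL]
      simp only [Pi.smul_apply, Pi.add_apply, Pi.sub_apply, smul_eq_mul, hcdef]
      ring
    simp only
    rw [heq]
    refine (eLpNorm_add_le (((hnorm n).1.sub hmem.1).const_smul _) (hmem.1.const_smul _)
      (by simpa using ENNReal.ofReal_le_ofReal hγ.le)).trans ?_
    rw [eLpNorm_const_smul, eLpNorm_const_smul]
  · rw [hL]
    simp only [Pi.smul_apply, smul_eq_mul]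
    rw [integral_const_mul, hmean, W.integral_normWalk hμ0 hμ 0, mul_one]

end RWES

theorem mainTheorem4 {Ω : Type*} [MeasurableSpace Ω] (P : Measure Ω) [IsProbabilityMeasure P]
    (μ : Measure ℝ) [IsProbabilityMeasure μ]
    (hμ_nonneg : ∀ᵐ x ∂μ, 0 ≤ x)
    (hμ_zero : μ {0} < 1)
    (hμ_memLp : ∃ α : ℝ, 1 < α ∧ MemLp (fun x : ℝ => x) (ENNReal.ofReal α) μ)
    (W : RWES P 1 (Measure.dirac 1) μ) :
    ∃ L : Ω → ℝ,
      Integrable L P ∧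
      (∀ᵐ ω ∂P, Tendsto (fun n : ℕ => W.walk n ω / (n : ℝ) ^ echoMoment μ 1) atTop (𝓝 (L ω))) ∧
      ((∫ x, x * Real.log x ∂μ) < echoMoment μ 1 →
        (∀ γ ∈ echoExponents (Measure.dirac 1) μ,
          MemLp L (ENNReal.ofReal γ) P ∧
          (∀ n : ℕ, MemLp (fun ω => W.walk n ω / (n : ℝ) ^ echoMoment μ 1)
            (ENNReal.ofReal γ) P) ∧
          Tendsto (fun n : ℕ => eLpNorm
            (fun ω => W.walk n ω / (n : ℝ) ^ echoMoment μ 1 - L ω) (ENNReal.ofReal γ) P)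
            atTop (𝓝 0)) ∧
        (∫ ω, L ω ∂P) = 1 / Real.Gamma (1 + echoMoment μ 1) ∧
        (μ {1} < 1 → ¬ ∃ c : ℝ, ∀ᵐ ω ∂P, L ω = c)) ∧
      (echoMoment μ 1 ≤ (∫ x, x * Real.log x ∂μ) → ∀ᵐ ω ∂P, L ω = 0) := by
  obtain ⟨α, hα, hαL⟩ := hμ_memLp
  have hμ : Integrable (fun x : ℝ => x) μ :=
    hαL.integrable (by simpa using ENNReal.ofReal_le_ofReal hα.le)
  have hint : Integrable (fun x : ℝ => x ^ α) μ := by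
    have h := hαL.integrable_norm_rpow (by simpa using (by linarith : 0 < α)) ENNReal.ofReal_ne_top
    rw [ENNReal.toReal_ofReal (by linarith)] at h
    refine h.congr ?_
    filter_upwards [hμ_nonneg] with x hx
    rw [Real.norm_of_nonneg hx]
  have hm := RWES.echoMoment_one_pos hμ_nonneg hμ hμ_zero
  have hwalk := W.walk_ae_eq_pureWalk
  refine ⟨W.limitWalk, W.integrable_limitWalk hμ_nonneg hμ, ?_, fun hlog => ⟨?_, ?_, ?_⟩,
    W.limitWalk_ae_eq_zero hμ_nonneg hμ hm hα hint⟩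
  · filter_upwards [W.ae_tendsto_limitWalk hμ_nonneg hμ hm, hwalk] with ω h1 h2
    simpa only [h2] using h1
  · rintro γ ⟨hγ, -, hγi, hγlt⟩
    obtain ⟨h1, h2, h3, -⟩ := W.tendsto_eLpNorm_pureWalk hμ_nonneg hμ hm hγ hγi hγlt
    refine ⟨h1, fun n => (memLp_congr_ae ?_).2 (h2 n), h3.congr fun n => eLpNorm_congr_ae ?_⟩
    · filter_upwards [hwalk] with ω h
      rw [h]
    · filter_upwards [hwalk] with ω h
      rw [h]
  · obtain ⟨γ, hγ, hγi, hγlt⟩ := exists_echoMoment_lt hμ_nonneg hμ hα hint hlog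
    exact (W.tendsto_eLpNorm_pureWalk hμ_nonneg hμ hm hγ hγi hγlt).2.2.2
  · rintro hμ1 ⟨c, hc⟩
    obtain ⟨γ, hγ, hγi, hγlt⟩ := exists_echoMoment_lt hμ_nonneg hμ hα hint hlog
    have hmean := (W.tendsto_eLpNorm_pureWalk hμ_nonneg hμ hm hγ hγi hγlt).2.2.2
    rw [integral_congr_ae hc] at hmean
    -- A constant limit equals its mean 1/Γ(1 + m_1), which is positive.
    have hc0 : c ≠ 0 := by
      rintro rfl
      have := (one_div_pos.2 (Real.Gamma_pos_of_pos (by linarith : 0 < 1 + echoMoment μ 1))).ne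
      simp only [integral_zero] at hmean
      exact this hmean
    have h1 := W.echo_eq_one_of_limitWalk_const hμ_nonneg hμ hm hc0 hc
    exact hμ1.ne ((prob_compl_eq_zero_iff (measurableSet_singleton 1)).1 h1)
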